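/- Let $m,M>0$. For $k\in\mathbb{R}^3$ put $F_k(k')=\frac{|k|^2}{2m}-\frac{|k'|^2}{2m}-\frac{|k-k'|^2}{2M}$ and let $q(k,\cdot)$ be the finite measure on $\mathbb{R}^3$ $$q(k,B)=\int_{B\cap F_k^{-1}(0)}|\nabla F_k(k')|^{-1}\,H(dk'),$$ where $H$ is the two-dimensional surface (Hausdorff) measure. Let $\Sigma(k)=q(k,\mathbb{R}^3)$. Fix $(x,k)\in\mathbb{R}^3\times\mathbb{R}^3$ and let $(X_t,K_t)_{t\ge 0}$ be the following process started from $(X_0,K_0)=(x,k)$: $(K_t)$ is the Markov jump process with jump kernel $q$, that is, $K_t=\kappa_{N_t}$, where $(\kappa_n)_{n\ge0}$ is a Markov chain with $\kappa_0=k$ and transition probabilities $q(\kappa,\cdot)/\Sigma(\kappa)$ (a state with $\Sigma(\kappa)=0$, i.e. $\kappa=0$, being absorbing), $(\lambda_n)_{n\ge0}$ are independent exponential random variables with mean $1$, independent of $(\kappa_n)$, $T_n=\sum_{j<n}\lambda_j/\Sigma(\kappa_j)$ and $N_t=\sup\{n: T_n\le t\}$; and $$X_t=x+\int_0^t \frac{K_s}{m}\,ds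 .$$ Then: 1. Almost surely $|K_t|=|K_0|\,t^{-1+o(1)}$ as $t\to\infty$. 2. $X_t$ is integrable for every $t\ge0$; if $k\ne0$, then $\lim_{t\to\infty}\mathbb{E}|X_t|=\infty$; and $\sup_{t\ge0}|\mathbb{E}X_t|<\infty$. -/

import Mathlib

open MeasureTheory ProbabilityTheory Filter Topology Set
open scoped ENNReal Gradient

noncomputable section

namespace QuantumFriction

/-- Three-dimensional Euclidean space. -/
abbrev E3 : Type := EuclideanSpace ℝ (Fin 3)

/-- The kinetic energy of a tracer particle of mass `m` and momentum `k`. -/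
def tracerEnergy (m : ℝ) (k : E3) : ℝ := 1 / (2 * m) * ‖k‖ ^ 2

/-- The kinetic energy of a Bose atom of mass `M` and momentum `p`. -/
def bosonEnergy (M : ℝ) (p : E3) : ℝ := 1 / (2 * M) * ‖p‖ ^ 2

/-- The energy defect of the emission `k → k'`; the emission conserves energy iff it vanishes. -/
def energyDefect (m M : ℝ) (k k' : E3) : ℝ :=
  tracerEnergy m k - tracerEnergy m k' - bosonEnergy M (k - k')

/-- The jump kernel `q(k, dk') = δ(F_k(k')) dk'`, where `F_k` is the energy defect, that is,
`q(k, B) = ∫_{B ∩ {F_k = 0}} |∇F_k(k')|⁻¹ H(dk')` with `H` the surface measure (the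
two-dimensional Hausdorff measure, normalized so as to agree with area). -/
def jumpKernel (m M : ℝ) (k : E3) : Measure E3 :=
  ((μHE[2] : Measure E3).restrict {k' | energyDefect m M k k' = 0}).withDensity
    (fun k' => ‖∇ (energyDefect m M k) k'‖ₑ⁻¹)

/-- The scattering rate `Σ(k) = q(k, ℝ³)`. -/
def scatteringRate (m M : ℝ) (k : E3) : ℝ≥0∞ := jumpKernel m M k univ

open Classical in
/-- The normalized transition kernel `p(k, ·) = q(k, ·) / Σ(k)`.  A state with `Σ(k) = 0`
is absorbing. -/
def transition (m M : ℝ) (k : E3) : Measure E3 :=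
  if scatteringRate m M k = 0 then Measure.dirac k
  else (scatteringRate m M k)⁻¹ • jumpKernel m M k

variable {Ω : Type*} [MeasurableSpace Ω]

/-- `κ` is a (time-homogeneous, discrete-time) Markov chain with transition probabilities `p`,
started from the point `k`. -/
structure IsMarkovChainFrom (p : E3 → Measure E3) (k : E3) (P : Measure Ω)
    (κ : ℕ → Ω → E3) : Prop where
  measurable : ∀ n, Measurable (κ n)
  initial : ∀ᵐ ω ∂P, κ 0 ω = k
  markov : ∀ (n : ℕ) (B : Set E3), MeasurableSet B →
    P⟦κ (n + 1) ⁻¹' B | ⨆ j ≤ n, MeasurableSpace.comap (κ j) inferInstance⟧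
      =ᵐ[P] fun ω => (p (κ n ω)).real B

/-- `lam` is a sequence of independent exponential random variables with mean `1`. -/
structure IsExpSequence (P : Measure Ω) (lam : ℕ → Ω → ℝ) : Prop where
  measurable : ∀ n, Measurable (lam n)
  law : ∀ n, P.map (lam n) = expMeasure 1
  indep : iIndepFun lam P

/-- The time `T_n = ∑_{j < n} λ_j / Σ(κ_j)` of the `n`-th jump; it is infinite if the chain has
reached an absorbing state before. -/
def jumpTime (m M : ℝ) (κ : ℕ → Ω → E3) (lam : ℕ → Ω → ℝ) (n : ℕ) (ω : Ω) : ℝ≥0∞ :=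
  ∑ j ∈ Finset.range n, ENNReal.ofReal (lam j ω) / scatteringRate m M (κ j ω)

/-- The number `N_t` of jumps up to time `t` (the right-continuous inverse of `n ↦ T_n`). -/
def jumpCount (m M : ℝ) (κ : ℕ → Ω → E3) (lam : ℕ → Ω → ℝ) (t : ℝ) (ω : Ω) : ℕ :=
  sSup {n : ℕ | jumpTime m M κ lam n ω ≤ ENNReal.ofReal t}

/-- `(X_t, K_t)_{t ≥ 0}` is the position and momentum of the tracer particle started from the
point `(x, k)`: the momentum is the Markov jump process with jump kernel `q`, that is, it runs
through a Markov chain `κ_n` with transition kernel `q / Σ` and jumps with rate `Σ(κ_n)` while it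
is in the state `κ_n`; and the position has velocity `K_t / m`. -/
def IsTracerProcess (m M : ℝ) (x k : E3) (P : Measure Ω) (X K : ℝ → Ω → E3) : Prop :=
  (∃ (κ : ℕ → Ω → E3) (lam : ℕ → Ω → ℝ),
    IsMarkovChainFrom (transition m M) k P κ ∧
    IsExpSequence P lam ∧
    IndepFun (fun ω n => κ n ω) (fun ω n => lam n ω) P ∧
    ∀ᵐ ω ∂P, ∀ t : ℝ, 0 ≤ t → K t ω = κ (jumpCount m M κ lam t ω) ω) ∧
  ∀ᵐ ω ∂P, ∀ t : ℝ, 0 ≤ t → X t ω = x + ∫ s in (0 : ℝ)..t, m⁻¹ • K s ω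

end QuantumFriction

end

/-! Put `a = m / (m + M)`. Completing the square shows that the momenta allowed after `k` form the
sphere with centre `a • k` and radius `(1 - a) * ‖k‖`, on which `∇ F_k` has constant norm. Hence the
jump rate is `c * ‖k‖`, with `c` the constant `rateConst m M`, and the chain is the recursion `κ (n
+ 1) = a • κ n + ((1 - a) * ‖κ n‖) • U n` with independent uniform directions `U n`
(`jumpKernel_eq`, `transition_eq`, `chain_jumpDir_law`).

Decay. By rotation invariance `log ‖κ n‖` is a random walk. Its steps have a finite negative mean
`-γ`, so the strong law gives `log ‖κ n‖ ∼ -γ n` (`ae_tendsto_log_norm_chain`). The holding times `λ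
n / (c * ‖κ n‖)`, and therefore the jump times `T n`, grow like `exp (γ n)`. Thus `log t ∼ γ N_t`,
and `log ‖K_t‖ ∼ -γ N_t ∼ -log t` (`IsTypical.exists_norm_eq_rpow`).

Position. The mean direction after a jump is `dirCorr a < 1` times the old direction. Since the jump
rate and the speed are both proportional to `‖K‖`, the process `X + H • K / ‖K‖` is a martingale for
the constant `H = 1 / (m * c * (1 - dirCorr a))`. It differs from `X` by a bounded term, so `𝔼 X_t`
is bounded. If `𝔼 ‖X_t‖` did not tend to infinity, the martingale at the jump times would be bounded
in `L¹` and would converge; but its increments contain the independent clocks `λ n / (m * c)`, which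
do not settle (`exists_lt_integral_abs_stepMartingale`). The time `t` and the jump times are linked
by the same martingale stopped at `t`, run over the jumps (`isStepPair_cut`). -/

noncomputable section

namespace QuantumFriction

open Metric Module

/-! ### Surface measure on the unit sphere -/

theorem euclideanHausdorffMeasure_image_le {X Y : Type*} [EMetricSpace X] [EMetricSpace Y]
    [MeasurableSpace X] [BorelSpace X] [MeasurableSpace Y] [BorelSpace Y] {K : NNReal} {f : X → Y}
    {s : Set X} (h : LipschitzOnWith K f s) (d : ℕ) :
    (μHE[d] : Measure Y) (f '' s) ≤ (K : ℝ≥0∞) ^ d * (μHE[d] : Measure X) s := by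
  simp_rw [Measure.euclideanHausdorffMeasure_def, Measure.smul_apply, ENNReal.smul_def, smul_eq_mul]
  rw [mul_left_comm]
  gcongr
  simpa using h.hausdorffMeasure_image_le (d := d) (by positivity)

theorem norm_normalize_sub_normalize_le {V : Type*} [NormedAddCommGroup V] [NormedSpace ℝ V]
    {v w : V} (hv : 1 ≤ ‖v‖) (hw : 1 ≤ ‖w‖) :
    ‖‖v‖⁻¹ • v - ‖w‖⁻¹ • w‖ ≤ 2 * ‖v - w‖ := by
  have hv0 : 0 < ‖v‖ := by linarith
  have hw0 : 0 < ‖w‖ := by linarith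
  have h1 : ‖v‖⁻¹ • v - ‖w‖⁻¹ • w = ‖v‖⁻¹ • (v - w) + (‖v‖⁻¹ * (‖w‖ - ‖v‖)) • (‖w‖⁻¹ • w) := by
    have : ‖v‖⁻¹ * (‖w‖ - ‖v‖) * ‖w‖⁻¹ = ‖v‖⁻¹ - ‖w‖⁻¹ := by field_simp
    rw [smul_smul, this]
    module
  have h2 : |‖w‖ - ‖v‖| ≤ ‖v - w‖ := by
    rw [norm_sub_rev]; exact abs_norm_sub_norm_le _ _
  have h3 : ‖v‖⁻¹ ≤ 1 := inv_le_one_of_one_le₀ hv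
  have h4 : 0 ≤ ‖v‖⁻¹ := by positivity
  rw [h1]
  refine (norm_add_le _ _).trans ?_
  rw [norm_smul, norm_smul, norm_smul, norm_mul, norm_inv, norm_inv, norm_norm, norm_norm,
    inv_mul_cancel₀ hw0.ne', mul_one, Real.norm_eq_abs]
  nlinarith [norm_nonneg (v - w), abs_nonneg (‖w‖ - ‖v‖),
    mul_le_mul_of_nonneg_right h3 (norm_nonneg (v - w)),
    mul_le_mul_of_nonneg_right h3 (abs_nonneg (‖w‖ - ‖v‖))]

theorem finrank_orthogonal_singleton_E3 {e : E3} (he : ‖e‖ = 1) : finrank ℝ (ℝ ∙ e)ᗮ = 2 := by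
  have : Fact (finrank ℝ E3 = 2 + 1) := ⟨by simp⟩
  exact Submodule.finrank_orthogonal_span_singleton (by rintro rfl; simp at he)

theorem isAddHaarMeasure_orthogonal_singleton {e : E3} (he : ‖e‖ = 1) :
    (μHE[2] : Measure (ℝ ∙ e)ᗮ).IsAddHaarMeasure := by
  have h := finrank_orthogonal_singleton_E3 he
  rw [← h]
  infer_instance

/-- Small spherical caps have at most quadratic area. -/
theorem exists_cap_le {e : E3} (he : ‖e‖ = 1) :
    ∃ C : NNReal, ∀ r : ℝ, 0 < r → r ≤ 1 →
      (μHE[2] : Measure E3) (sphere 0 1 ∩ ball e r) ≤ C * ENNReal.ofReal (r ^ 2) := by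
  have := isAddHaarMeasure_orthogonal_singleton he
  have hfin := finrank_orthogonal_singleton_E3 he
  set W := (ℝ ∙ e)ᗮ with hW
  -- Central projection of the tangent plane at `e` onto the sphere. It is 2-Lipschitz because `‖e +
  -- w‖ ≥ 1`.
  let ψ : W → E3 := fun w => ‖e + (w : E3)‖⁻¹ • (e + (w : E3))
  have horth (w : W) : inner ℝ e (w : E3) = 0 :=
    (Submodule.mem_orthogonal_singleton_iff_inner_right).1 w.2
  have hge (w : W) : 1 ≤ ‖e + (w : E3)‖ := by
    have h1 := norm_add_sq_real e (w : E3)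
    rw [horth, he] at h1
    nlinarith [norm_nonneg (e + (w : E3)), sq_nonneg ‖(w : E3)‖]
  have hψ : LipschitzWith 2 ψ := by
    refine LipschitzWith.of_dist_le_mul fun v w => ?_
    rw [dist_eq_norm, dist_eq_norm]
    refine (norm_normalize_sub_normalize_le (hge v) (hge w)).trans (le_of_eq ?_)
    simp
  have hball : (μHE[2] : Measure W) (ball 0 1) ≠ ∞ := measure_ball_lt_top.ne
  refine ⟨(2 ^ 2 * (ENNReal.ofReal (2 ^ 2) * (μHE[2] : Measure W) (ball 0 1))).toNNReal,
    fun r hr hr1 => ?_⟩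
  rw [ENNReal.coe_toNNReal (by finiteness)]
  -- With `s = ⟪e, u⟫`, the preimage of `u` is `s⁻¹ • u - e`. As `r ≤ 1` forces `s > 1 / 2`, its
  -- norm is less than `2 * r`.
  have hsub : sphere 0 1 ∩ ball e r ⊆ ψ '' ball 0 (2 * r) := by
    rintro u ⟨hu, hur⟩
    have hu : ‖u‖ = 1 := by simpa using hu
    have hur : ‖u - e‖ < r := by simpa [dist_eq_norm] using hur
    set s := inner ℝ e u with hs
    have hs' : ‖u - e‖ ^ 2 = 2 - 2 * s := by
      rw [norm_sub_sq_real, hu, he, real_inner_comm]; ring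
    have hs2 : 1 / 2 < s := by nlinarith [norm_nonneg (u - e)]
    have hmem : s⁻¹ • u - e ∈ W := by
      rw [hW, Submodule.mem_orthogonal_singleton_iff_inner_right, inner_sub_right,
        real_inner_smul_right, ← hs, real_inner_self_eq_norm_sq, he]
      field_simp
      simp
    refine ⟨⟨s⁻¹ • u - e, hmem⟩, ?_, ?_⟩
    · have hn : ‖u - s • e‖ ≤ ‖u - e‖ := by
        have : ‖u - s • e‖ ^ 2 = 1 - s ^ 2 := by
          rw [norm_sub_sq_real, hu, norm_smul, he, real_inner_smul_right, real_inner_comm, ← hs,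
            Real.norm_eq_abs, mul_one, sq_abs]; ring
        refine le_of_sq_le_sq ?_ (norm_nonneg _)
        nlinarith [sq_nonneg (s - 1)]
      have h3 : s⁻¹ • u - e = s⁻¹ • (u - s • e) := by
        rw [smul_sub, smul_smul, inv_mul_cancel₀ (by linarith), one_smul]
      have h4 : s⁻¹ < 2 := by
        rw [inv_lt_comm₀ (by linarith) (by norm_num)]; linarith
      have h5 : 0 < s⁻¹ := by positivity
      simp only [mem_ball, dist_zero_right, Submodule.coe_norm]
      rw [h3, norm_smul, Real.norm_of_nonneg h5.le]
      nlinarith [norm_nonneg (u - s • e)]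
    · have h6 : 0 < s⁻¹ := by positivity
      simp only [ψ, add_sub_cancel, norm_smul, hu, Real.norm_of_nonneg h6.le, mul_one, smul_smul]
      rw [inv_mul_cancel₀ h6.ne', one_smul]
  calc (μHE[2] : Measure E3) (sphere 0 1 ∩ ball e r)
      ≤ (μHE[2] : Measure E3) (ψ '' ball 0 (2 * r)) := measure_mono hsub
    _ ≤ 2 ^ 2 * (μHE[2] : Measure W) (ball 0 (2 * r)) := by
        simpa using euclideanHausdorffMeasure_image_le (hψ.lipschitzOnWith (s := ball 0 (2 * r))) 2
    _ = _ := by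
        have : Nontrivial W := nontrivial_of_finrank_pos (R := ℝ) (by omega)
        rw [Measure.addHaar_ball _ _ (by positivity), hfin, mul_pow, ENNReal.ofReal_mul (by norm_num)]
        ring

theorem sphere_measure_lt_top : (μHE[2] : Measure E3) (sphere 0 1) < ∞ := by
  refine (isCompact_sphere (0 : E3) 1).measure_lt_top_of_nhdsWithin fun e he => ?_
  obtain ⟨C, hC⟩ := exists_cap_le (e := e) (by simpa using he)
  refine ⟨sphere 0 1 ∩ ball e 1, inter_mem_nhdsWithin _ (ball_mem_nhds e one_pos), ?_⟩
  exact (hC 1 one_pos le_rfl).trans_lt (by finiteness)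

/-- Orthogonal projection onto a plane is 1-Lipschitz and the image of the sphere covers the unit
disc, whose area is positive. -/
theorem sphere_measure_ne_zero : (μHE[2] : Measure E3) (sphere 0 1) ≠ 0 := by
  intro h0
  let e : E3 := EuclideanSpace.single 0 1
  have he : ‖e‖ = 1 := by simp [e]
  have := isAddHaarMeasure_orthogonal_singleton he
  set W := (ℝ ∙ e)ᗮ with hW
  have hsub : ball (0 : W) 1 ⊆ W.orthogonalProjectionOnto '' sphere 0 1 := by
    intro w hw
    have hw : ‖(w : E3)‖ < 1 := by simpa using hw
    have horth : inner ℝ (w : E3) e = 0 :=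
      (Submodule.mem_orthogonal_singleton_iff_inner_left).1 w.2
    refine ⟨w + √(1 - ‖(w : E3)‖ ^ 2) • e, ?_, ?_⟩
    · have h1 : 0 ≤ 1 - ‖(w : E3)‖ ^ 2 := by nlinarith [norm_nonneg (w : E3)]
      have h2 : ‖(w : E3) + √(1 - ‖(w : E3)‖ ^ 2) • e‖ ^ 2 = 1 := by
        rw [norm_add_sq_real, real_inner_smul_right, horth, norm_smul, he, mul_one,
          Real.norm_eq_abs, sq_abs, Real.sq_sqrt h1]
        ring
      rw [mem_sphere_zero_iff_norm]
      exact (pow_eq_one_iff_of_nonneg (norm_nonneg _) two_ne_zero).1 h2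
    · have he' : W.orthogonalProjectionOnto e = 0 :=
        Submodule.orthogonalProjectionOnto_apply_of_mem_orthogonal
          (Submodule.le_orthogonal_orthogonal _ (Submodule.mem_span_singleton_self e))
      rw [map_add, map_smul, he', smul_zero, add_zero,
        Submodule.orthogonalProjectionOnto_mem_subspace_eq_self]
  have h1 : (μHE[2] : Measure W) (ball 0 1) ≤ 0 := by
    calc _ ≤ (μHE[2] : Measure W) (W.orthogonalProjectionOnto '' sphere 0 1) := measure_mono hsub
      _ ≤ (1 : NNReal) ^ 2 * (μHE[2] : Measure E3) (sphere 0 1) := by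
        exact_mod_cast euclideanHausdorffMeasure_image_le
          (W.lipschitzWith_orthogonalProjectionOnto.lipschitzOnWith (s := sphere 0 1)) 2
      _ = 0 := by rw [h0, mul_zero]
  exact (measure_ball_pos (μHE[2] : Measure W) 0 one_pos).ne' (le_zero_iff.1 h1)

/-- The uniform distribution on the unit sphere. -/
def unif : Measure E3 := cond (μHE[2] : Measure E3) (sphere 0 1)

instance : IsProbabilityMeasure unif :=
  cond_isProbabilityMeasure_of_finite sphere_measure_ne_zero sphere_measure_lt_top.ne

theorem unif_apply (s : Set E3) : unif s =
    ((μHE[2] : Measure E3) (sphere 0 1))⁻¹ * (μHE[2] : Measure E3) (sphere 0 1 ∩ s) :=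
  cond_apply isClosed_sphere.measurableSet _ _

theorem ae_unif_norm_eq_one : ∀ᵐ u ∂unif, ‖u‖ = 1 := by
  filter_upwards [ae_cond_mem (μ := (μHE[2] : Measure E3))
      (isClosed_sphere (x := (0 : E3)) (ε := 1)).measurableSet]
    with u hu
  simpa using hu

theorem exists_unif_ball_le {e : E3} (he : ‖e‖ = 1) :
    ∃ C : ℝ, 0 ≤ C ∧ ∀ r : ℝ, 0 < r → r ≤ 1 → unif.real (ball e r) ≤ C * r ^ 2 := by
  obtain ⟨C, hC⟩ := exists_cap_le he
  have h0 := sphere_measure_ne_zero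
  refine ⟨(((μHE[2] : Measure E3) (sphere 0 1))⁻¹ * C).toReal, by positivity, fun r hr hr1 => ?_⟩
  rw [measureReal_def, unif_apply]
  calc _ ≤ (((μHE[2] : Measure E3) (sphere 0 1))⁻¹ * (C * ENNReal.ofReal (r ^ 2))).toReal := by
        refine ENNReal.toReal_mono ?_ (by gcongr; exact hC r hr hr1)
        finiteness
    _ = _ := by
        rw [← mul_assoc, ENNReal.toReal_mul, ENNReal.toReal_ofReal (by positivity)]

theorem unif_singleton (e : E3) : unif {e} = 0 := by
  by_cases he : ‖e‖ = 1
  · obtain ⟨C, hC0, hC⟩ := exists_unif_ball_le he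
    have h1 : unif.real {e} ≤ 0 := by
      refine ge_of_tendsto (f := fun r : ℝ => C * r ^ 2) (x := 𝓝[>] 0) ?_ ?_
      · have : Tendsto (fun r : ℝ => C * r ^ 2) (𝓝 0) (𝓝 (C * 0 ^ 2)) :=
          (continuous_const.mul (continuous_pow 2)).tendsto _
        simpa using this.mono_left nhdsWithin_le_nhds
      · filter_upwards [Ioo_mem_nhdsGT one_pos] with r hr
        exact (measureReal_mono (by simpa using hr.1)).trans (hC r hr.1 hr.2.le)
    have h2 := le_antisymm h1 measureReal_nonneg
    simpa [measureReal_def, ENNReal.toReal_eq_zero_iff] using h2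
  · refine measure_mono_null ?_ (ae_iff.1 ae_unif_norm_eq_one)
    simpa using he

/-- Isometries preserve Hausdorff measure, and linear ones also the unit sphere. All symmetry
arguments rest on this. -/
theorem map_unif (Q : E3 ≃ₗᵢ[ℝ] E3) : unif.map Q = unif := by
  ext s hs
  rw [Measure.map_apply Q.continuous.measurable hs, unif_apply, unif_apply]
  congr 1
  rw [← (Q.toIsometryEquiv.measurePreserving_euclideanHausdorffMeasure 2).measure_preimage
    (isClosed_sphere.measurableSet.inter hs).nullMeasurableSet]
  congr 1
  ext u
  simp

theorem integral_unif_comp {V : Type*} [NormedAddCommGroup V] [NormedSpace ℝ V]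
    (Q : E3 ≃ₗᵢ[ℝ] E3) (f : E3 → V) : ∫ u, f (Q u) ∂unif = ∫ u, f u ∂unif := by
  conv_rhs => rw [← map_unif Q]
  exact (integral_map_equiv Q.toHomeomorph.toMeasurableEquiv f).symm

/-- The normalization of a vector (with value `0` at `0`). -/
def dir (v : E3) : E3 := ‖v‖⁻¹ • v

theorem norm_dir {v : E3} (hv : v ≠ 0) : ‖dir v‖ = 1 := norm_smul_inv_norm (𝕜 := ℝ) hv

theorem norm_dir_le (v : E3) : ‖dir v‖ ≤ 1 := by
  by_cases hv : v = 0
  · simp [dir, hv]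
  · exact (norm_dir hv).le

theorem norm_smul_dir (v : E3) : ‖v‖ • dir v = v := by
  by_cases hv : v = 0
  · simp [dir, hv]
  · rw [dir, smul_smul, mul_inv_cancel₀ (norm_ne_zero_iff.2 hv), one_smul]

theorem dir_smul {c : ℝ} (hc : 0 < c) (v : E3) : dir (c • v) = dir v := by
  rw [dir, dir, norm_smul, Real.norm_of_nonneg hc.le, smul_smul, mul_inv, mul_right_comm,
    inv_mul_cancel₀ hc.ne', one_mul]

@[fun_prop]
theorem measurable_dir : Measurable dir := by
  unfold dir; fun_prop

/-- The rotation-invariant step: the momentum after a jump from `k` in direction `u`. -/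
def step (a : ℝ) (k u : E3) : E3 := a • k + ((1 - a) * ‖k‖) • u

@[fun_prop]
theorem continuous_step (a : ℝ) : Continuous fun p : E3 × E3 => step a p.1 p.2 := by
  unfold step; fun_prop

theorem step_map (a : ℝ) (Q : E3 ≃ₗᵢ[ℝ] E3) (k u : E3) : step a (Q k) (Q u) = Q (step a k u) := by
  simp [step]

theorem step_smul (a : ℝ) {c : ℝ} (hc : 0 ≤ c) (k u : E3) : step a (c • k) u = c • step a k u := by
  simp only [step, norm_smul, Real.norm_of_nonneg hc]
  module

theorem step_eq_norm_smul (a : ℝ) (k u : E3) : step a k u = ‖k‖ • step a (dir k) u := by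
  rw [← step_smul _ (norm_nonneg _), norm_smul_dir]

theorem exists_linearIsometryEquiv_apply_eq {e e' : E3} (h : ‖e‖ = ‖e'‖) :
    ∃ Q : E3 ≃ₗᵢ[ℝ] E3, Q e = e' :=
  ⟨(ℝ ∙ (e - e'))ᗮ.reflection, Submodule.reflection_sub h⟩

theorem norm_step_le {a : ℝ} (ha0 : 0 ≤ a) (ha1 : a ≤ 1) (k : E3) {u : E3} (hu : ‖u‖ = 1) :
    ‖step a k u‖ ≤ ‖k‖ := by
  refine (norm_add_le _ _).trans (le_of_eq ?_)
  rw [norm_smul, norm_smul, norm_mul, norm_norm, hu, Real.norm_of_nonneg ha0,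
    Real.norm_of_nonneg (by linarith)]
  ring

/-- The difference of the squares of the two sides is `(2 * a - 1) ^ 2`. The bound isolates the only
possible singularity of `log ‖step a e u‖`, at `u = -e`, which occurs for equal masses. -/
theorem le_norm_step {a : ℝ} (ha0 : 0 ≤ a) (ha1 : a ≤ 1) {e u : E3} (he : ‖e‖ = 1)
    (hu : ‖u‖ = 1) : √(a * (1 - a)) * ‖u + e‖ ≤ ‖step a e u‖ := by
  have h0 : 0 ≤ a * (1 - a) := mul_nonneg ha0 (by linarith)
  refine le_of_sq_le_sq ?_ (norm_nonneg _)
  rw [mul_pow, Real.sq_sqrt h0, step, norm_add_sq_real, norm_add_sq_real, norm_smul, norm_smul,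
    real_inner_smul_left, real_inner_smul_right, norm_mul, norm_norm, he, hu,
    real_inner_comm, Real.norm_of_nonneg ha0, Real.norm_of_nonneg (sub_nonneg.2 ha1)]
  nlinarith [sq_nonneg (a - (1 - a))]

theorem ae_unif_ne (e : E3) : ∀ᵐ u ∂unif, u ≠ e := by
  rw [ae_iff]; simpa using unif_singleton e

/-- Layer-cake formula: the level set above `t` lies, up to a null set, in a cap of radius `exp
(-t)`, whose measure is at most `C * exp (-2 * t)`. -/
theorem integrable_max_neg_log_norm_add {e : E3} (he : ‖e‖ = 1) :
    Integrable (fun u => max 0 (-Real.log ‖u + e‖)) unif := by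
  obtain ⟨C, hC0, hC⟩ := exists_unif_ball_le (e := -e) (by simpa using he)
  have hmeas : Measurable fun u : E3 => max 0 (-Real.log ‖u + e‖) := by fun_prop
  refine ⟨hmeas.aestronglyMeasurable, ?_⟩
  have hnn (u : E3) : 0 ≤ max 0 (-Real.log ‖u + e‖) := le_max_left _ _
  rw [hasFiniteIntegral_iff_ofReal (Eventually.of_forall hnn),
    lintegral_eq_lintegral_meas_lt _ (Eventually.of_forall hnn)
      hmeas.aemeasurable]
  calc ∫⁻ t in Ioi (0 : ℝ), unif {u | t < max 0 (-Real.log ‖u + e‖)}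
      ≤ ∫⁻ t in Ioi (0 : ℝ), ENNReal.ofReal (C * Real.exp (-2 * t)) := by
        refine setLIntegral_mono (by fun_prop) fun t ht => ?_
        have ht : 0 < t := ht
        have hexp : Real.exp (-2 * t) = Real.exp (-t) ^ 2 := by
          rw [← Real.exp_nat_mul]; congr 1; push_cast; ring
        have hle := hC (Real.exp (-t)) (Real.exp_pos _) (by simpa using ht.le)
        rw [← hexp] at hle
        -- The null point `-e` is split off so that the norm under the logarithm is positive.
        have hsub : {u | t < max 0 (-Real.log ‖u + e‖)} ⊆ ball (-e) (Real.exp (-t)) ∪ {-e} := by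
          intro u hu
          by_cases hue : u = -e
          · exact Or.inr hue
          · left
            have hpos : 0 < ‖u + e‖ := norm_pos_iff.2 fun h => hue (eq_neg_of_add_eq_zero_left h)
            have h1 : t < -Real.log ‖u + e‖ := (lt_max_iff.1 hu).resolve_left ht.not_gt
            rw [mem_ball, dist_eq_norm, sub_neg_eq_add, ← Real.log_lt_iff_lt_exp hpos]
            linarith
        calc unif {u | t < max 0 (-Real.log ‖u + e‖)}
            ≤ unif (ball (-e) (Real.exp (-t))) + unif {-e} :=
              (measure_mono hsub).trans (measure_union_le _ _)
          _ = ENNReal.ofReal (unif.real (ball (-e) (Real.exp (-t)))) := by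
              rw [unif_singleton, add_zero, ofReal_measureReal]
          _ ≤ _ := ENNReal.ofReal_le_ofReal hle
    _ < ∞ := by
        have hi : IntegrableOn (fun t : ℝ => C * Real.exp (-2 * t)) (Ioi 0) :=
          (exp_neg_integrableOn_Ioi 0 two_pos).const_mul C
        have := hi.2
        rwa [hasFiniteIntegral_iff_ofReal (Eventually.of_forall fun t => by positivity)] at this

theorem norm_step_pos_of_ne {a : ℝ} (ha0 : 0 < a) (ha1 : a < 1) {e u : E3} (he : ‖e‖ = 1)
    (hu : ‖u‖ = 1) (hne : u ≠ -e) : 0 < ‖step a e u‖ := by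
  have hpos : 0 < ‖u + e‖ := norm_pos_iff.2 fun h => hne (eq_neg_of_add_eq_zero_left h)
  have hc : 0 < √(a * (1 - a)) := Real.sqrt_pos.2 (mul_pos ha0 (by linarith))
  exact (mul_pos hc hpos).trans_le (le_norm_step ha0.le ha1.le he hu)

theorem integrable_log_norm_step {a : ℝ} (ha0 : 0 < a) (ha1 : a < 1) {e : E3} (he : ‖e‖ = 1) :
    Integrable (fun u => Real.log ‖step a e u‖) unif := by
  have hc : 0 < √(a * (1 - a)) := Real.sqrt_pos.2 (mul_pos ha0 (by linarith))
  refine ((integrable_max_neg_log_norm_add he).add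
    (integrable_const (-Real.log √(a * (1 - a))))).mono' ?_ ?_
  · have : Measurable fun u => Real.log ‖step a e u‖ := by fun_prop
    exact this.aestronglyMeasurable
  · filter_upwards [ae_unif_norm_eq_one, ae_unif_ne (-e)] with u hu hne
    have hpos : 0 < ‖u + e‖ := norm_pos_iff.2 fun h => hne (eq_neg_of_add_eq_zero_left h)
    have h1 := le_norm_step ha0.le ha1.le he hu
    have h2 : ‖step a e u‖ ≤ 1 := he ▸ norm_step_le ha0.le ha1.le e hu
    have h3 := Real.log_le_log (mul_pos hc hpos) h1
    rw [Real.log_mul hc.ne' hpos.ne'] at h3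
    rw [Real.norm_of_nonpos (Real.log_nonpos (norm_nonneg _) h2)]
    simp only [Pi.add_apply]
    linarith [le_max_right 0 (-Real.log ‖u + e‖)]

/-- The mean of the logarithm of the ratio of successive momenta. -/
def drift (a : ℝ) : ℝ := ∫ u, Real.log ‖step a (EuclideanSpace.single 0 1) u‖ ∂unif

/-- An isometry taking `e` to `e'` preserves `unif` and commutes with `step`. So the ratio of
successive norms has a law that does not depend on the current direction. -/
theorem map_norm_step_unif (a : ℝ) {e e' : E3} (h : ‖e‖ = ‖e'‖) :
    unif.map (fun u => ‖step a e u‖) = unif.map (fun u => ‖step a e' u‖) := by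
  obtain ⟨Q, rfl⟩ := exists_linearIsometryEquiv_apply_eq h
  conv_rhs => rw [← map_unif Q, Measure.map_map (by fun_prop) Q.continuous.measurable]
  congr 1
  ext u
  simp [step_map]

theorem norm_step_lt {a : ℝ} (ha0 : 0 < a) (ha1 : a < 1) {e u : E3} (he : ‖e‖ = 1) (hu : ‖u‖ = 1)
    (hne : u ≠ e) : ‖step a e u‖ < 1 := by
  have h1 : inner ℝ e u < (1 : ℝ) := by
    refine lt_of_le_of_ne (by simpa [he, hu] using real_inner_le_norm e u) fun h => hne ?_
    exact ((inner_eq_one_iff_of_norm_eq_one he hu).1 h).symm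
  refine lt_of_pow_lt_pow_left₀ 2 zero_le_one ?_
  have h2 : 0 < a * (1 - a) := mul_pos ha0 (by linarith)
  rw [step, norm_add_sq_real, norm_smul, norm_smul, real_inner_smul_left, real_inner_smul_right,
    norm_mul, norm_norm, he, hu, Real.norm_of_nonneg ha0.le, Real.norm_of_nonneg (sub_nonneg.2 ha1.le)]
  nlinarith

theorem integral_pos_of_ae_pos {α : Type*} [MeasurableSpace α] {μ : Measure α} [NeZero μ]
    {f : α → ℝ} (hf : Integrable f μ) (hpos : ∀ᵐ x ∂μ, 0 < f x) : 0 < ∫ x, f x ∂μ := by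
  have hnn : 0 ≤ᵐ[μ] f := hpos.mono fun x hx => hx.le
  refine lt_of_le_of_ne (integral_nonneg_of_ae hnn) fun h => ?_
  have h0 := (integral_eq_zero_iff_of_nonneg_ae hnn hf).1 h.symm
  obtain ⟨x, hx, hx'⟩ := (hpos.and h0).exists
  exact hx.ne' hx'

/-- The new momentum is a strict convex combination of two unit vectors, distinct almost surely, so
its norm is less than `1`. -/
theorem drift_neg {a : ℝ} (ha0 : 0 < a) (ha1 : a < 1) : drift a < 0 := by
  set e : E3 := EuclideanSpace.single 0 1 with he_def
  have he : ‖e‖ = 1 := by simp [e]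
  have hneg : ∀ᵐ u ∂unif, 0 < -Real.log ‖step a e u‖ := by
    filter_upwards [ae_unif_norm_eq_one, ae_unif_ne (-e), ae_unif_ne e] with u hu h1 h2
    exact neg_pos.2 (Real.log_neg (norm_step_pos_of_ne ha0 ha1 he hu h1)
      (norm_step_lt ha0 ha1 he hu h2))
  have h := integral_pos_of_ae_pos (integrable_log_norm_step ha0 ha1 he).neg hneg
  rw [integral_neg'] at h
  exact neg_pos.1 h

/-- The mean direction of the momentum after a jump from the unit vector `e` is
`dirCorr a • e`. -/
def dirCorr (a : ℝ) : ℝ :=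
  inner ℝ (EuclideanSpace.single 0 1) (∫ u, dir (step a (EuclideanSpace.single 0 1) u) ∂unif)

theorem dir_map (Q : E3 ≃ₗᵢ[ℝ] E3) (v : E3) : dir (Q v) = Q (dir v) := by
  simp [dir]

theorem integrable_dir_step (a : ℝ) (k : E3) : Integrable (fun u => dir (step a k u)) unif :=
  Integrable.of_bound (Measurable.aestronglyMeasurable (by fun_prop)) 1
    (Eventually.of_forall fun u => norm_dir_le _)

theorem integral_dir_step_map (a : ℝ) (Q : E3 ≃ₗᵢ[ℝ] E3) (e : E3) :
    ∫ u, dir (step a (Q e) u) ∂unif = Q (∫ u, dir (step a e u) ∂unif) := by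
  rw [← integral_unif_comp Q]
  simp_rw [step_map, dir_map]
  exact Q.toContinuousLinearEquiv.integral_comp_comm _

/-- The mean is fixed by the reflection in the line through `e`, because `unif` is; hence it lies on
that line. The coefficient is the same for all `e` by rotation. -/
theorem integral_dir_step (a : ℝ) {e : E3} (he : ‖e‖ = 1) :
    ∫ u, dir (step a e u) ∂unif = dirCorr a • e := by
  obtain ⟨Q, hQ⟩ := exists_linearIsometryEquiv_apply_eq
    (e := EuclideanSpace.single 0 1) (e' := e) (by simp [he])
  set e₀ : E3 := EuclideanSpace.single 0 1 with he_def
  have he₀ : ‖e₀‖ = 1 := by simp [e₀]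
  have h1 : ∫ u, dir (step a e₀ u) ∂unif = dirCorr a • e₀ := by
    have h2 := integral_dir_step_map a (ℝ ∙ e₀).reflection e₀
    rw [Submodule.reflection_mem_subspace_eq_self (Submodule.mem_span_singleton_self e₀),
      eq_comm, Submodule.reflection_eq_self_iff] at h2
    obtain ⟨c, hc⟩ := Submodule.mem_span_singleton.1 h2
    rw [dirCorr, ← he_def, ← hc, real_inner_smul_right, real_inner_self_eq_norm_sq, he₀]
    simp
  rw [← hQ, integral_dir_step_map, h1, map_smul]

/-- The new direction equals `e` only if `u` is `e` or `-e`, which is a null event. This makes the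
constant `H` of the martingale finite and positive. -/
theorem dirCorr_lt_one {a : ℝ} (ha1 : a < 1) : dirCorr a < 1 := by
  set e : E3 := EuclideanSpace.single 0 1 with he_def
  have he : ‖e‖ = 1 := by simp [e]
  have hint := (integrable_dir_step a e).const_inner (𝕜 := ℝ) e
  have h1 : dirCorr a = ∫ u, inner ℝ e (dir (step a e u)) ∂unif := by
    rw [integral_inner (integrable_dir_step a e)]; rfl
  have h2 : ∀ᵐ u ∂unif, 0 < 1 - inner ℝ e (dir (step a e u)) := by
    filter_upwards [ae_unif_norm_eq_one, ae_unif_ne (-e), ae_unif_ne e] with u hu hu1 hu2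
    have hle : inner ℝ e (dir (step a e u)) ≤ (1 : ℝ) := by
      refine (real_inner_le_norm _ _).trans ?_
      rw [he, one_mul]; exact norm_dir_le _
    refine sub_pos.2 (lt_of_le_of_ne hle fun h => ?_)
    -- Here `dir 0 = 0` would give inner product `0` instead of `1`.
    have hv : step a e u ≠ 0 := by
      intro hv
      simp [hv, dir] at h
    have hdir := (inner_eq_one_iff_of_norm_eq_one he (norm_dir hv)).1 h
    have h4 : step a e u = ‖step a e u‖ • e := by
      conv_lhs => rw [← norm_smul_dir (step a e u), ← hdir]
    have h5 : u = ((1 - a)⁻¹ * (‖step a e u‖ - a)) • e := by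
      have : (1 - a) • u = (‖step a e u‖ - a) • e := by
        rw [sub_smul ‖_‖, ← h4, step, he]; module
      rw [mul_smul, ← this, smul_smul, inv_mul_cancel₀ (by linarith), one_smul]
    rw [h5, norm_smul, he, mul_one, Real.norm_eq_abs] at hu
    rcases eq_or_eq_neg_of_abs_eq hu with h6 | h6 <;> rw [h6] at h5
    · exact hu2 (by simpa using h5)
    · exact hu1 (by simpa using h5)
  have h3 := integral_pos_of_ae_pos ((integrable_const _).sub hint) h2
  rw [integral_sub' (integrable_const _) hint, ← h1] at h3
  simpa using h3

/-! ### The jump kernel as a uniform distribution on a sphere -/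

theorem energyDefect_eq {m M : ℝ} (hm : 0 < m) (hM : 0 < M) (k k' : E3) :
    energyDefect m M k k' = (m + M) / (2 * m * M) *
      (((1 - m / (m + M)) * ‖k‖) ^ 2 - ‖k' - (m / (m + M)) • k‖ ^ 2) := by
  have h : 0 < m + M := by positivity
  rw [energyDefect, tracerEnergy, tracerEnergy, bosonEnergy, norm_sub_sq_real, norm_sub_sq_real,
    norm_smul, real_inner_smul_right, real_inner_comm, Real.norm_of_nonneg (by positivity)]
  field_simp
  ring

theorem energyDefect_eq_zero_iff {m M : ℝ} (hm : 0 < m) (hM : 0 < M) (k k' : E3) :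
    energyDefect m M k k' = 0 ↔ ‖k' - (m / (m + M)) • k‖ = (1 - m / (m + M)) * ‖k‖ := by
  have h : 0 < m + M := by positivity
  have h1 : 0 ≤ 1 - m / (m + M) := by
    rw [sub_nonneg, div_le_one h]; linarith
  rw [energyDefect_eq hm hM, mul_eq_zero, or_iff_right (by positivity), sub_eq_zero, eq_comm,
    sq_eq_sq₀ (norm_nonneg _) (by positivity)]

theorem gradient_energyDefect {m M : ℝ} (hm : 0 < m) (hM : 0 < M) (k k' : E3) :
    ∇ (energyDefect m M k) k' = -((m + M) / (m * M)) • (k' - (m / (m + M)) • k) := by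
  refine HasGradientAt.gradient ?_
  rw [hasGradientAt_iff_hasFDerivAt]
  have h1 : HasFDerivAt (fun y : E3 => ‖y - (m / (m + M)) • k‖ ^ 2)
      (2 • (innerSL ℝ (k' - (m / (m + M)) • k)).comp (ContinuousLinearMap.id ℝ E3)) k' :=
    ((hasFDerivAt_id k').sub_const _).norm_sq
  have h2 := ((h1.const_sub (((1 - m / (m + M)) * ‖k‖) ^ 2)).const_mul ((m + M) / (2 * m * M)))
  refine (h2.congr_of_eventuallyEq (Eventually.of_forall fun y => energyDefect_eq hm hM k y)).congr_fderiv
    ?_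
  ext v
  simp
  field_simp

open scoped Pointwise in
theorem restrict_sphere_eq (c : E3) {r : ℝ} (hr : 0 < r) :
    (μHE[2] : Measure E3).restrict (sphere c r) =
      ENNReal.ofReal (r ^ 2) •
        ((μHE[2] : Measure E3).restrict (sphere 0 1)).map (fun u => c + r • u) := by
  ext s hs
  have hmeas : Measurable fun u : E3 => c + r • u := by fun_prop
  rw [Measure.smul_apply, Measure.map_apply hmeas hs, Measure.restrict_apply hs,
    Measure.restrict_apply (hmeas hs)]
  have himg : s ∩ sphere c r = (fun v : E3 => c + v) ''
      (r • ((fun u => c + r • u) ⁻¹' s ∩ sphere 0 1)) := by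
    ext v
    simp only [mem_inter_iff, mem_sphere, dist_eq_norm, mem_image, Set.mem_smul_set, mem_preimage,
      sub_zero]
    constructor
    · rintro ⟨hv, hvr⟩
      refine ⟨v - c, ⟨r⁻¹ • (v - c), ⟨?_, ?_⟩, ?_⟩, by simp⟩
      · rwa [smul_inv_smul₀ hr.ne', add_sub_cancel]
      · rw [norm_smul, hvr, Real.norm_of_nonneg (by positivity), inv_mul_cancel₀ hr.ne']
      · rw [smul_inv_smul₀ hr.ne']
    · rintro ⟨w, ⟨u, ⟨hu, hu1⟩, rfl⟩, rfl⟩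
      refine ⟨hu, ?_⟩
      rw [add_sub_cancel_left, norm_smul, hu1, Real.norm_of_nonneg hr.le, mul_one]
  rw [himg, (isometry_add_left c).euclideanHausdorffMeasure_image,
    Measure.euclideanHausdorffMeasure_smul₀ _ hr.ne']
  rw [ENNReal.smul_def, smul_eq_mul, smul_eq_mul]
  congr 1
  rw [ENNReal.ofReal, ENNReal.coe_inj, Real.toNNReal_pow hr.le]
  congr 1
  exact Real.nnnorm_of_nonneg hr.le |>.trans (by rw [Real.toNNReal_of_nonneg hr.le])

/-- The ratio of the scattering rate at `k` to `‖k‖`. -/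
def rateConst (m M : ℝ) : ℝ :=
  m * (1 - m / (m + M)) ^ 2 * (μHE[2] : Measure E3).real (sphere 0 1)

theorem rateConst_pos {m M : ℝ} (hm : 0 < m) (hM : 0 < M) : 0 < rateConst m M := by
  have h : 0 < 1 - m / (m + M) := by
    rw [sub_pos, div_lt_one (by positivity)]; linarith
  have h1 : 0 < (μHE[2] : Measure E3).real (sphere 0 1) :=
    ENNReal.toReal_pos sphere_measure_ne_zero sphere_measure_lt_top.ne
  unfold rateConst; positivity

/-- On the sphere the gradient has norm `‖k‖ / m`, so the density is the constant `m / ‖k‖`. The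
area is proportional to `‖k‖ ^ 2`, which leaves a total mass linear in `‖k‖`. -/
theorem jumpKernel_eq {m M : ℝ} (hm : 0 < m) (hM : 0 < M) {k : E3} (hk : k ≠ 0) :
    jumpKernel m M k =
      ENNReal.ofReal (rateConst m M * ‖k‖) • unif.map (step (m / (m + M)) k) := by
  have hk0 : 0 < ‖k‖ := norm_pos_iff.2 hk
  have hb : 0 < 1 - m / (m + M) := by
    rw [sub_pos, div_lt_one (by positivity)]; linarith
  have hr : 0 < (1 - m / (m + M)) * ‖k‖ := by positivity
  have hset : {k' | energyDefect m M k k' = 0} =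
      sphere ((m / (m + M)) • k) ((1 - m / (m + M)) * ‖k‖) := by
    ext k'
    rw [mem_ofPred_eq, energyDefect_eq_zero_iff hm hM, mem_sphere, dist_eq_norm]
  have hden : (fun k' => ‖∇ (energyDefect m M k) k'‖ₑ⁻¹) =ᵐ[(μHE[2] : Measure E3).restrict
      (sphere ((m / (m + M)) • k) ((1 - m / (m + M)) * ‖k‖))]
      fun _ => ENNReal.ofReal (m / ‖k‖) := by
    filter_upwards [ae_restrict_mem isClosed_sphere.measurableSet] with k' hk'
    rw [mem_sphere, dist_eq_norm] at hk'
    rw [gradient_energyDefect hm hM, ← ofReal_norm, norm_smul, hk', norm_neg,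
      Real.norm_of_nonneg (by positivity), ← ENNReal.ofReal_inv_of_pos (by positivity)]
    congr 1
    have hb' : 1 - m / (m + M) = M / (m + M) := by field_simp; ring
    rw [hb']
    field_simp
  rw [jumpKernel, hset, withDensity_congr_ae hden, withDensity_const, restrict_sphere_eq _ hr,
    unif, ProbabilityTheory.cond, Measure.map_smul, smul_smul, smul_smul]
  congr 1
  rw [rateConst, measureReal_def]
  have h0 := sphere_measure_ne_zero
  have h1 := sphere_measure_lt_top.ne
  set S := (μHE[2] : Measure E3) (sphere 0 1)
  rw [← ENNReal.ofReal_mul (by positivity), ← ENNReal.ofReal_toReal (ENNReal.inv_ne_top.2 h0),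
    ← ENNReal.ofReal_mul (by positivity), ENNReal.toReal_inv]
  congr 1
  have : S.toReal ≠ 0 := (ENNReal.toReal_pos h0 h1).ne'
  field_simp

theorem scatteringRate_eq {m M : ℝ} (hm : 0 < m) (hM : 0 < M) (k : E3) :
    scatteringRate m M k = ENNReal.ofReal (rateConst m M * ‖k‖) := by
  by_cases hk : k = 0
  · subst hk
    -- For `k = 0` the sphere degenerates to a point. It is null for the two-dimensional measure, so
    -- the infinite density there contributes nothing.
    have hset : {k' | energyDefect m M (0 : E3) k' = 0} = {0} := by
      ext k'
      simp [energyDefect_eq_zero_iff hm hM]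
    rw [scatteringRate, jumpKernel, hset]
    have h0 : (μHE[2] : Measure E3).restrict {0} = 0 := by
      rw [Measure.restrict_eq_zero, Measure.euclideanHausdorffMeasure_def, Measure.smul_apply]
      have := Measure.nullSingletonClass_hausdorff E3 (d := 2) two_pos
      simp
    rw [h0]
    simp
  · have := Measure.isProbabilityMeasure_map (μ := unif) (f := step (m / (m + M)) k)
      (Measurable.aemeasurable (by fun_prop))
    rw [scatteringRate, jumpKernel_eq hm hM hk, Measure.smul_apply, measure_univ, smul_eq_mul, mul_one]

/-- The convention that `0` is absorbing agrees with `step`, which maps `0` to `0`; one formula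
covers all states. -/
theorem transition_eq {m M : ℝ} (hm : 0 < m) (hM : 0 < M) (k : E3) :
    transition m M k = unif.map (step (m / (m + M)) k) := by
  by_cases hk : k = 0
  · subst hk
    have : step (m / (m + M)) 0 = fun _ => 0 := by ext; simp [step]
    rw [transition, if_pos (by simp [scatteringRate_eq hm hM]), this, Measure.map_const]
    simp
  · have h0 : 0 < rateConst m M * ‖k‖ := mul_pos (rateConst_pos hm hM) (norm_pos_iff.2 hk)
    rw [transition, if_neg (by simpa [scatteringRate_eq hm hM] using h0), jumpKernel_eq hm hM hk,
      scatteringRate_eq hm hM, smul_smul, ENNReal.inv_mul_cancel (by simpa using h0) (by simp),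
      one_smul]

/-! ### Independence, product laws and conditional expectations -/

section General

variable {Ω : Type*} {F : MeasurableSpace Ω} {mΩ : MeasurableSpace Ω} {P : Measure Ω}

theorem sup_eq_generateFrom_inter (m₁ m₂ : MeasurableSpace Ω) :
    m₁ ⊔ m₂ = MeasurableSpace.generateFrom
      (image2 (· ∩ ·) {s | MeasurableSet[m₁] s} {s | MeasurableSet[m₂] s}) := by
  apply le_antisymm
  · refine sup_le (fun s hs => ?_) fun s hs => ?_
    · exact MeasurableSpace.measurableSet_generateFrom
        ⟨s, hs, univ, @MeasurableSet.univ _ m₂, inter_univ s⟩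
    · exact MeasurableSpace.measurableSet_generateFrom
        ⟨univ, @MeasurableSet.univ _ m₁, s, hs, univ_inter s⟩
  · refine MeasurableSpace.generateFrom_le ?_
    rintro _ ⟨s, hs, t, ht, rfl⟩
    exact @MeasurableSet.inter _ (m₁ ⊔ m₂) _ _
      ((le_sup_left : m₁ ≤ m₁ ⊔ m₂) _ hs) ((le_sup_right : m₂ ≤ m₁ ⊔ m₂) _ ht)

theorem isPiSystem_image2_inter (m₁ m₂ : MeasurableSpace Ω) :
    IsPiSystem (image2 (· ∩ ·) {s | MeasurableSet[m₁] s} {s | MeasurableSet[m₂] s}) := by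
  rintro _ ⟨s, hs, t, ht, rfl⟩ _ ⟨s', hs', t', ht', rfl⟩ -
  exact ⟨s ∩ s', @MeasurableSet.inter _ m₁ _ _ hs hs', t ∩ t', @MeasurableSet.inter _ m₂ _ _ ht ht',
    inter_inter_inter_comm _ _ _ _⟩

/-- Probabilities of intersections factor completely, and intersections form a generating π-system.
Used with `m₁` the past of the chain, `m₂` its next direction, `m₃` the past clocks and `m₄` the
current clock. -/
theorem indep_sup_sup [IsProbabilityMeasure P] {m₁ m₂ m₃ m₄ : MeasurableSpace Ω}
    (h₁ : m₁ ≤ mΩ) (h₂ : m₂ ≤ mΩ) (h₃ : m₃ ≤ mΩ) (h₄ : m₄ ≤ mΩ)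
    (h₁₂ : Indep m₁ m₂ P) (h₃₄ : Indep m₃ m₄ P) (h : Indep (m₁ ⊔ m₂) (m₃ ⊔ m₄) P) :
    Indep (m₁ ⊔ m₃) (m₂ ⊔ m₄) P := by
  refine IndepSets.indep (sup_le h₁ h₃) (sup_le h₂ h₄) (isPiSystem_image2_inter m₁ m₃)
    (isPiSystem_image2_inter m₂ m₄) (sup_eq_generateFrom_inter _ _)
    (sup_eq_generateFrom_inter _ _) ?_
  rw [Indep_iff] at h₁₂ h₃₄ h
  rw [IndepSets_iff]
  rintro _ _ ⟨A, hA, B, hB, rfl⟩ ⟨C, hC, D, hD, rfl⟩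
  have hA' := (le_sup_left : m₁ ≤ m₁ ⊔ m₂) _ hA
  have hC' := (le_sup_right : m₂ ≤ m₁ ⊔ m₂) _ hC
  have hB' := (le_sup_left : m₃ ≤ m₃ ⊔ m₄) _ hB
  have hD' := (le_sup_right : m₄ ≤ m₃ ⊔ m₄) _ hD
  simp only
  rw [inter_inter_inter_comm, h _ _ (@MeasurableSet.inter _ (m₁ ⊔ m₂) _ _ hA' hC')
    (@MeasurableSet.inter _ (m₃ ⊔ m₄) _ _ hB' hD'), h _ _ hA' hB', h _ _ hC' hD',
    h₁₂ _ _ hA hC, h₃₄ _ _ hB hD, mul_mul_mul_comm]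

theorem map_restrict_prodMk_of_indep [IsFiniteMeasure P] {α β : Type*} [MeasurableSpace α]
    [MeasurableSpace β] (hF : F ≤ mΩ) {Y : Ω → α} {W : Ω → β}
    (hY : Measurable[F] Y) (hW : Measurable W)
    (hind : Indep F (MeasurableSpace.comap W inferInstance) P) {A : Set Ω}
    (hA : MeasurableSet[F] A) :
    (P.restrict A).map (fun ω => (Y ω, W ω)) = ((P.restrict A).map Y).prod (P.map W) := by
  have hY' := hY.mono hF le_rfl
  refine (Measure.prod_eq fun s t hs ht => ?_).symm
  rw [Indep_iff] at hind
  rw [Measure.map_apply (hY'.prodMk hW) (hs.prod ht), Measure.map_apply hY' hs,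
    Measure.map_apply hW ht, Measure.restrict_apply (hY' hs),
    Measure.restrict_apply ((hY'.prodMk hW) (hs.prod ht)), mk_preimage_prod,
    inter_right_comm]
  exact hind _ _ (@MeasurableSet.inter _ F _ _ (hY hs) hA) ⟨t, ht, rfl⟩

/-- On every event of `F` the pair `(Y, W)` has a product law, so by Fubini `W` may be integrated
out first, with `Y` frozen. -/
theorem condExp_eq_zero_of_indep [IsProbabilityMeasure P] {α β : Type*} [MeasurableSpace α]
    [MeasurableSpace β] (hF : F ≤ mΩ) {Y : Ω → α} {W : Ω → β}
    (hY : Measurable[F] Y) (hW : Measurable W)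
    (hind : Indep F (MeasurableSpace.comap W inferInstance) P) {g : α × β → ℝ} (hg : Measurable g)
    (hint : Integrable (fun ω => g (Y ω, W ω)) P)
    (h0 : ∀ᵐ ω ∂P, ∫ w, g (Y ω, w) ∂(P.map W) = 0) :
    P[fun ω => g (Y ω, W ω) | F] =ᵐ[P] 0 := by
  have hY' := hY.mono hF le_rfl
  have hYW := hY'.prodMk hW
  refine (ae_eq_condExp_of_forall_setIntegral_eq hF hint
    (fun s _ _ => (integrable_zero _ _ _).integrableOn) (fun A hA _ => ?_)
    aestronglyMeasurable_zero).symm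
  have hjoint := map_restrict_prodMk_of_indep hF hY hW hind hA
  have hintA : Integrable g ((P.restrict A).map (fun ω => (Y ω, W ω))) := by
    rw [integrable_map_measure hg.aestronglyMeasurable hYW.aemeasurable]
    exact hint.restrict
  have h1 : ∫ ω in A, g (Y ω, W ω) ∂P = ∫ p, g p ∂((P.restrict A).map (fun ω => (Y ω, W ω))) :=
    (integral_map hYW.aemeasurable hg.aestronglyMeasurable).symm
  have := Measure.isProbabilityMeasure_map (μ := P) hW.aemeasurable
  rw [hjoint] at hintA h1
  rw [h1, integral_prod _ hintA, integral_map hY'.aemeasurable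
    (hg.stronglyMeasurable.integral_prod_right').aestronglyMeasurable]
  rw [integral_congr_ae (ae_restrict_of_ae h0)]
  simp

/-- If the conditional distribution of `V` given `F` is the law of `f (Y, u)` with `u ∼ ν`, then
`(Y, V)` is jointly distributed like `(Y, f (Y, u))` with `u` independent of `F`. -/
theorem map_restrict_prodMk_of_condExp [IsProbabilityMeasure P] {α β γ : Type*} [MeasurableSpace α]
    [MeasurableSpace β] [MeasurableSpace γ] (hF : F ≤ mΩ) {Y : Ω → α}
    {V : Ω → β} (hY : Measurable[F] Y) (hV : Measurable V) {ν : Measure γ} [IsProbabilityMeasure ν]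
    {f : α × γ → β} (hf : Measurable f)
    (h : ∀ B : Set β, MeasurableSet B →
      P⟦V ⁻¹' B | F⟧ =ᵐ[P] fun ω => (ν.map fun u => f (Y ω, u)).real B)
    {A : Set Ω} (hA : MeasurableSet[F] A) :
    (P.restrict A).map (fun ω => (Y ω, V ω)) =
      (((P.restrict A).map Y).prod ν).map (fun p => (p.1, f p)) := by
  have hY' := hY.mono hF le_rfl
  have hf1 (y : α) : Measurable fun u => f (y, u) := hf.comp measurable_prodMk_left
  refine Measure.ext_prod fun {s t} hs ht => ?_
  rw [Measure.map_apply (hY'.prodMk hV) (hs.prod ht),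
    Measure.map_apply (measurable_fst.prodMk hf) (hs.prod ht),
    Measure.restrict_apply ((hY'.prodMk hV) (hs.prod ht)), mk_preimage_prod, inter_right_comm,
    Measure.prod_apply ((measurable_fst.prodMk hf) (hs.prod ht))]
  have hsA : MeasurableSet[F] (Y ⁻¹' s ∩ A) := @MeasurableSet.inter _ F _ _ (hY hs) hA
  have hR (y : α) : ν (Prod.mk y ⁻¹' ((fun p : α × γ => (p.1, f p)) ⁻¹' s ×ˢ t)) =
      s.indicator (fun y => ν {u | f (y, u) ∈ t}) y := by
    by_cases hy : y ∈ s
    · rw [indicator_of_mem hy]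
      congr 1
      ext u
      simp [hy]
    · rw [indicator_of_notMem hy]
      convert measure_empty (μ := ν)
      ext u
      simp [hy]
  have hmeas : Measurable fun y => ν {u | f (y, u) ∈ t} :=
    measurable_measure_prodMk_left (hf ht)
  rw [lintegral_congr hR, lintegral_indicator hs, setLIntegral_map hs hmeas hY',
    Measure.restrict_restrict (hY' hs)]
  have h1 := setIntegral_condExp hF (μ := P) (f := (V ⁻¹' t).indicator fun _ => (1 : ℝ))
    ((integrable_const _).indicator (hV ht)) hsA
  rw [setIntegral_congr_ae ((hF _ hsA)) ((h t ht).mono fun ω hω _ => hω),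
    setIntegral_indicator (hV ht), setIntegral_const, smul_eq_mul, mul_one] at h1
  have h2 : ∫⁻ ω in Y ⁻¹' s ∩ A, ν {u | f (Y ω, u) ∈ t} ∂P =
      ENNReal.ofReal (∫ ω in Y ⁻¹' s ∩ A, (ν.map fun u => f (Y ω, u)).real t ∂P) := by
    rw [ofReal_integral_eq_lintegral_ofReal]
    · refine lintegral_congr fun ω => ?_
      have : IsProbabilityMeasure (ν.map fun u => f (Y ω, u)) :=
        Measure.isProbabilityMeasure_map (hf1 _).aemeasurable
      rw [ofReal_measureReal, Measure.map_apply (hf1 _) ht]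
      rfl
    · refine Integrable.restrict ?_
      refine Integrable.of_bound (C := 1) ?_ ?_
      · refine Measurable.aestronglyMeasurable ?_
        simp_rw [measureReal_def, Measure.map_apply (hf1 _) ht]
        exact (hmeas.comp hY').ennreal_toReal
      · refine Eventually.of_forall fun ω => ?_
        have : IsProbabilityMeasure (ν.map fun u => f (Y ω, u)) :=
          Measure.isProbabilityMeasure_map (hf1 _).aemeasurable
        rw [Real.norm_of_nonneg measureReal_nonneg]
        exact measureReal_le_one
    · exact Eventually.of_forall fun ω => measureReal_nonneg
  rw [h2, h1, ofReal_measureReal]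

end General

/-! ### The chain as a recursion with independent uniform directions -/

/-- The direction `u` for which `v = step a y u`. -/
def jumpDir (a : ℝ) (y v : E3) : E3 := ((1 - a) * ‖y‖)⁻¹ • (v - a • y)

theorem jumpDir_step {a : ℝ} (ha1 : a < 1) {y : E3} (hy : y ≠ 0) (u : E3) :
    jumpDir a y (step a y u) = u := by
  have : (1 - a) * ‖y‖ ≠ 0 := mul_ne_zero (by linarith) (norm_ne_zero_iff.2 hy)
  rw [jumpDir, step, add_sub_cancel_left, inv_smul_smul₀ this]

theorem step_jumpDir {a : ℝ} (ha1 : a < 1) {y : E3} (hy : y ≠ 0) (v : E3) :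
    step a y (jumpDir a y v) = v := by
  have : (1 - a) * ‖y‖ ≠ 0 := mul_ne_zero (by linarith) (norm_ne_zero_iff.2 hy)
  rw [jumpDir, step, smul_inv_smul₀ this, add_sub_cancel]

@[fun_prop]
theorem measurable_jumpDir (a : ℝ) : Measurable fun p : E3 × E3 => jumpDir a p.1 p.2 := by
  unfold jumpDir; fun_prop

@[fun_prop]
theorem measurable_step (a : ℝ) : Measurable fun p : E3 × E3 => step a p.1 p.2 :=
  (continuous_step a).measurable

section Chain

variable {Ω : Type*}

/-- The information carried by the first `n + 1` states of the chain `κ`. -/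
@[reducible] def chainPast (κ : ℕ → Ω → E3) (n : ℕ) : MeasurableSpace Ω :=
  ⨆ j ≤ n, MeasurableSpace.comap (κ j) inferInstance

theorem chainPast_le {mΩ : MeasurableSpace Ω} {κ : ℕ → Ω → E3} (hκ : ∀ n, Measurable (κ n)) (n : ℕ) :
    chainPast κ n ≤ mΩ :=
  iSup₂_le fun j _ => (hκ j).comap_le

theorem measurable_chainPast (κ : ℕ → Ω → E3) {j n : ℕ} (hj : j ≤ n) :
    Measurable[chainPast κ n] (κ j) :=
  Measurable.of_comap_le (le_iSup₂_of_le (f := fun j (_ : j ≤ n) =>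
    MeasurableSpace.comap (κ j) inferInstance) j hj le_rfl)

variable {a : ℝ} {κ : ℕ → Ω → E3}

/-- The logarithm of the ratio of successive momenta. -/
def logRatio (a : ℝ) (κ : ℕ → Ω → E3) (n : ℕ) (ω : Ω) : ℝ :=
  Real.log ‖step a (dir (κ n ω)) (jumpDir a (κ n ω) (κ (n + 1) ω))‖

theorem logRatio_eq (ha1 : a < 1) {n : ℕ} {ω : Ω} (h : ∀ n, κ n ω ≠ 0) :
    logRatio a κ n ω = Real.log ‖κ (n + 1) ω‖ - Real.log ‖κ n ω‖ := by
  have h1 : ‖κ (n + 1) ω‖ = ‖κ n ω‖ * ‖step a (dir (κ n ω)) (jumpDir a (κ n ω) (κ (n + 1) ω))‖ := by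
    conv_lhs => rw [← step_jumpDir ha1 (h n) (κ (n + 1) ω), step_eq_norm_smul, norm_smul, norm_norm]
  have h2 : ‖step a (dir (κ n ω)) (jumpDir a (κ n ω) (κ (n + 1) ω))‖ ≠ 0 := by
    intro h0
    rw [h0, mul_zero] at h1
    exact h (n + 1) (norm_eq_zero.1 h1)
  rw [h1, Real.log_mul (norm_ne_zero_iff.2 (h n)) h2, logRatio]
  ring

theorem measurable_logRatio_chainPast (κ : ℕ → Ω → E3) (a : ℝ) {j n : ℕ} (hj : j < n) :
    Measurable[chainPast κ n] (logRatio a κ j) := by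
  have h1 := measurable_chainPast κ hj.le
  have h2 := measurable_chainPast κ (Nat.succ_le_of_lt hj)
  unfold logRatio
  fun_prop

variable {k : E3} [mΩ : MeasurableSpace Ω] {P : Measure Ω} [IsProbabilityMeasure P]

theorem chain_joint_law (hκ : IsMarkovChainFrom (fun y => unif.map (step a y)) k P κ) (n : ℕ)
    {A : Set Ω} (hA : MeasurableSet[chainPast κ n] A) :
    (P.restrict A).map (fun ω => (κ n ω, κ (n + 1) ω)) =
      (((P.restrict A).map (κ n)).prod unif).map (fun p => (p.1, step a p.1 p.2)) :=
  map_restrict_prodMk_of_condExp (f := fun p : E3 × E3 => step a p.1 p.2)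
    (chainPast_le hκ.measurable n) (measurable_chainPast κ le_rfl) (hκ.measurable _)
    (measurable_step a) (fun B hB => hκ.markov n B hB) hA

theorem ae_step_ne_zero (ha1 : a < 1) {y : E3} (hy : y ≠ 0) : ∀ᵐ u ∂unif, step a y u ≠ 0 := by
  filter_upwards [ae_unif_ne (jumpDir a y 0)] with u hu h
  exact hu (by rw [← h, jumpDir_step ha1 hy])

/-- From a nonzero state exactly one vector `u` leads to `0`, and single points are null for `unif`.
-/
theorem ae_chain_ne_zero (ha1 : a < 1) (hk : k ≠ 0)
    (hκ : IsMarkovChainFrom (fun y => unif.map (step a y)) k P κ) :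
    ∀ᵐ ω ∂P, ∀ n, κ n ω ≠ 0 := by
  rw [ae_all_iff]
  intro n
  induction n with
  | zero => filter_upwards [hκ.initial] with ω hω; rwa [hω]
  | succ n ih =>
    have hpair := (hκ.measurable n).prodMk (hκ.measurable (n + 1))
    have h := chain_joint_law hκ n (@MeasurableSet.univ _ (chainPast κ n))
    rw [Measure.restrict_univ] at h
    have hs : MeasurableSet {p : E3 × E3 | p.2 ≠ 0} :=
      (measurable_snd (measurableSet_singleton (0 : E3))).compl
    have hg : Measurable fun p : E3 × E3 => (p.1, step a p.1 p.2) := by fun_prop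
    have h1 : ∀ᵐ p ∂(P.map fun ω => (κ n ω, κ (n + 1) ω)), p.2 ≠ 0 := by
      rw [h, ae_map_iff hg.aemeasurable hs]
      refine (Measure.ae_prod_iff_ae_ae (hg hs)).2 ?_
      have h2 : ∀ᵐ y ∂P.map (κ n), y ≠ 0 :=
        (ae_map_iff (hκ.measurable n).aemeasurable (measurableSet_singleton (0 : E3)).compl).2 ih
      filter_upwards [h2] with y hy using ae_step_ne_zero ha1 hy
    exact (ae_map_iff hpair.aemeasurable hs).1 h1

/-- Away from `y = 0`, `jumpDir` undoes `step`. The uniform directions are thus read off from the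
chain itself, without enlarging the probability space. -/
theorem chain_jumpDir_law (ha1 : a < 1) (hk : k ≠ 0)
    (hκ : IsMarkovChainFrom (fun y => unif.map (step a y)) k P κ) (n : ℕ)
    {A : Set Ω} (hA : MeasurableSet[chainPast κ n] A) :
    (P.restrict A).map (fun ω => (κ n ω, jumpDir a (κ n ω) (κ (n + 1) ω))) =
      ((P.restrict A).map (κ n)).prod unif := by
  have hpair := (hκ.measurable n).prodMk (hκ.measurable (n + 1))
  have hD : Measurable fun p : E3 × E3 => (p.1, jumpDir a p.1 p.2) := by fun_prop
  have hg : Measurable fun p : E3 × E3 => (p.1, step a p.1 p.2) := by fun_prop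
  have h := congrArg (Measure.map fun p : E3 × E3 => (p.1, jumpDir a p.1 p.2))
    (chain_joint_law hκ n hA)
  rw [Measure.map_map hD hpair, Measure.map_map hD hg] at h
  refine h.trans ?_
  conv_rhs => rw [← Measure.map_id (μ := ((P.restrict A).map (κ n)).prod unif)]
  refine Measure.map_congr ?_
  have h0 : ∀ᵐ p ∂((P.restrict A).map (κ n)).prod unif, p.1 ≠ 0 := by
    have hs : MeasurableSet {y : E3 | y ≠ 0} := (measurableSet_singleton (0 : E3)).compl
    refine Measure.quasiMeasurePreserving_fst.ae (p := fun y : E3 => y ≠ 0) ?_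
    rw [ae_map_iff (hκ.measurable n).aemeasurable hs]
    exact ae_restrict_of_ae ((ae_chain_ne_zero ha1 hk hκ).mono fun ω hω => hω n)
  filter_upwards [h0] with p hp
  simp [jumpDir_step ha1 hp]

theorem indep_chainPast_jumpDir (ha1 : a < 1) (hk : k ≠ 0)
    (hκ : IsMarkovChainFrom (fun y => unif.map (step a y)) k P κ) (n : ℕ) :
    P.map (fun ω => jumpDir a (κ n ω) (κ (n + 1) ω)) = unif ∧
    Indep (chainPast κ n)
      (MeasurableSpace.comap (fun ω => jumpDir a (κ n ω) (κ (n + 1) ω)) inferInstance) P := by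
  have hU : Measurable fun ω => jumpDir a (κ n ω) (κ (n + 1) ω) := by
    have := hκ.measurable n
    have := hκ.measurable (n + 1)
    fun_prop
  have hsnd {A : Set Ω} (hA : MeasurableSet[chainPast κ n] A) {B : Set E3} (hB : MeasurableSet B) :
      P ((fun ω => jumpDir a (κ n ω) (κ (n + 1) ω)) ⁻¹' B ∩ A) = P A * unif B := by
    have h := congrArg (fun μ => μ (univ ×ˢ B)) (chain_jumpDir_law ha1 hk hκ n hA)
    simp only [Measure.prod_prod] at h
    rw [Measure.map_apply ((hκ.measurable n).prodMk hU) (MeasurableSet.univ.prod hB),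
      Measure.map_apply (hκ.measurable n) MeasurableSet.univ, preimage_univ,
      Measure.restrict_apply_univ, mk_preimage_prod, preimage_univ, univ_inter,
      Measure.restrict_apply (hU hB)] at h
    exact h
  have hlaw : P.map (fun ω => jumpDir a (κ n ω) (κ (n + 1) ω)) = unif := by
    ext B hB
    rw [Measure.map_apply hU hB]
    simpa using hsnd (@MeasurableSet.univ _ (chainPast κ n)) hB
  refine ⟨hlaw, ?_⟩
  rw [Indep_iff]
  rintro A _ hA ⟨B, hB, rfl⟩
  rw [inter_comm, hsnd hA hB, ← hlaw, Measure.map_apply hU hB]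

/-- The log ratio depends on the present state only through its direction, and by
`map_norm_step_unif` its conditional law is the same for all directions. -/
theorem logRatio_law_indep (ha1 : a < 1) (hk : k ≠ 0)
    (hκ : IsMarkovChainFrom (fun y => unif.map (step a y)) k P κ) (n : ℕ) :
    P.map (logRatio a κ n) = unif.map (fun u => Real.log ‖step a (EuclideanSpace.single 0 1) u‖) ∧
    Indep (chainPast κ n) (MeasurableSpace.comap (logRatio a κ n) inferInstance) P := by
  have hU : Measurable fun ω => jumpDir a (κ n ω) (κ (n + 1) ω) := by
    have := hκ.measurable n
    have := hκ.measurable (n + 1)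
    fun_prop
  have hR : Measurable (logRatio a κ n) :=
    (measurable_logRatio_chainPast κ a n.lt_succ_self).mono (chainPast_le hκ.measurable _) le_rfl
  set ν := unif.map (fun u => Real.log ‖step a (EuclideanSpace.single 0 1) u‖) with hν
  have hg : Measurable fun p : E3 × E3 => Real.log ‖step a (dir p.1) p.2‖ := by fun_prop
  have hfib {y : E3} (hy : y ≠ 0) : unif.map (fun u => Real.log ‖step a (dir y) u‖) = ν := by
    have h := congrArg (Measure.map Real.log)
      (map_norm_step_unif a (e := dir y) (e' := EuclideanSpace.single 0 1) (by simp [norm_dir hy]))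
    rwa [Measure.map_map Real.measurable_log (by fun_prop),
      Measure.map_map Real.measurable_log (by fun_prop)] at h
  have hmain {A : Set Ω} (hA : MeasurableSet[chainPast κ n] A) {B : Set ℝ} (hB : MeasurableSet B) :
      P (logRatio a κ n ⁻¹' B ∩ A) = P A * ν B := by
    have h := congrArg (fun μ => μ ((fun p : E3 × E3 => Real.log ‖step a (dir p.1) p.2‖) ⁻¹' B))
      (chain_jumpDir_law ha1 hk hκ n hA)
    rw [Measure.map_apply ((hκ.measurable n).prodMk hU) (hg hB), Measure.prod_apply (hg hB),
      Measure.restrict_apply (((hκ.measurable n).prodMk hU) (hg hB)),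
      lintegral_map (measurable_measure_prodMk_left (hg hB)) (hκ.measurable n)] at h
    refine h.trans ?_
    have h2 : ∀ᵐ ω ∂P.restrict A, unif (Prod.mk (κ n ω) ⁻¹'
        ((fun p : E3 × E3 => Real.log ‖step a (dir p.1) p.2‖) ⁻¹' B)) = ν B := by
      filter_upwards [ae_restrict_of_ae (ae_chain_ne_zero ha1 hk hκ)] with ω hω
      rw [← hfib (hω n), Measure.map_apply (by fun_prop) hB]
      rfl
    rw [lintegral_congr_ae h2, lintegral_const, Measure.restrict_apply_univ, mul_comm]
  have hlaw : P.map (logRatio a κ n) = ν := by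
    ext B hB
    rw [Measure.map_apply hR hB]
    simpa using hmain (@MeasurableSet.univ _ (chainPast κ n)) hB
  refine ⟨hlaw, ?_⟩
  rw [Indep_iff]
  rintro A _ hA ⟨B, hB, rfl⟩
  rw [inter_comm, hmain hA hB, ← hlaw, Measure.map_apply hR hB]

/-- The log ratios are integrable, pairwise independent and identically distributed, and their sums
telescope to `log ‖κ n‖ - log ‖κ 0‖`; the strong law applies. -/
theorem ae_tendsto_log_norm_chain (ha0 : 0 < a) (ha1 : a < 1) (hk : k ≠ 0)
    (hκ : IsMarkovChainFrom (fun y => unif.map (step a y)) k P κ) :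
    ∀ᵐ ω ∂P, Tendsto (fun n : ℕ => Real.log ‖κ n ω‖ / n) atTop (𝓝 (drift a)) := by
  have hR (n : ℕ) : Measurable (logRatio a κ n) :=
    (measurable_logRatio_chainPast κ a n.lt_succ_self).mono (chainPast_le hκ.measurable _) le_rfl
  have hs : Measurable fun u => Real.log ‖step a (EuclideanSpace.single 0 1) u‖ := by fun_prop
  have hlaw := fun n => (logRatio_law_indep ha1 hk hκ n).1
  have hint : Integrable (logRatio a κ 0) P := by
    have h : Integrable id (P.map (logRatio a κ 0)) := by
      rw [hlaw, integrable_map_measure aestronglyMeasurable_id hs.aemeasurable]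
      exact integrable_log_norm_step ha0 ha1 (by simp)
    exact (integrable_map_measure aestronglyMeasurable_id (hR 0).aemeasurable).1 h
  have hmean : ∫ ω, logRatio a κ 0 ω ∂P = drift a := by
    have h1 := integral_map (f := id) hs.aemeasurable (μ := unif) aestronglyMeasurable_id
    rw [← hlaw 0, integral_map (hR 0).aemeasurable aestronglyMeasurable_id] at h1
    exact h1
  have hlt {i j : ℕ} (hij : i < j) : IndepFun (logRatio a κ i) (logRatio a κ j) P := by
    rw [IndepFun_iff_Indep]
    exact indep_of_indep_of_le_left (logRatio_law_indep ha1 hk hκ j).2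
      (measurable_logRatio_chainPast κ a hij).comap_le
  have hslln := strong_law_ae_real (logRatio a κ) hint
    (fun i j hij => hij.lt_or_gt.elim hlt fun h => (hlt h).symm)
    (fun i => ⟨(hR i).aemeasurable, (hR 0).aemeasurable, by rw [hlaw, hlaw]⟩)
  rw [hmean] at hslln
  filter_upwards [hslln, ae_chain_ne_zero ha1 hk hκ] with ω hω h0
  have hsum (n : ℕ) : ∑ i ∈ Finset.range n, logRatio a κ i ω =
      Real.log ‖κ n ω‖ - Real.log ‖κ 0 ω‖ := by
    rw [← Finset.sum_range_sub (fun i => Real.log ‖κ i ω‖)]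
    exact Finset.sum_congr rfl fun i _ => logRatio_eq ha1 h0
  have h2 := hω.add (tendsto_const_div_atTop_nhds_zero_nat (Real.log ‖κ 0 ω‖))
  rw [add_zero] at h2
  refine h2.congr fun n => ?_
  rw [hsum, ← add_div, sub_add_cancel]

end Chain

/-! ### Moments of the exponential distribution -/

section Exponential

instance : IsProbabilityMeasure (expMeasure 1) := isProbabilityMeasure_expMeasure one_pos

theorem expMeasure_real_Iic {s : ℝ} (hs : 0 ≤ s) :
    (expMeasure 1).real (Iic s) = 1 - Real.exp (-s) := by
  rw [← cdf_eq_real, cdf_expMeasure_eq one_pos, if_pos hs, one_mul]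

theorem expMeasure_real_Ioi {s : ℝ} (hs : 0 ≤ s) :
    (expMeasure 1).real (Ioi s) = Real.exp (-s) := by
  rw [← compl_Iic, probReal_compl_eq_one_sub measurableSet_Iic, expMeasure_real_Iic hs,
    sub_sub_cancel]

theorem ae_expMeasure_pos : ∀ᵐ l ∂expMeasure 1, 0 < l := by
  rw [ae_iff]
  have h := expMeasure_real_Iic le_rfl
  simp only [neg_zero, Real.exp_zero, sub_self] at h
  simpa [measureReal_def, ENNReal.toReal_eq_zero_iff, Iic_def] using h

theorem integrable_id_expMeasure : Integrable (fun l : ℝ => l) (expMeasure 1) := by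
  have hnn : 0 ≤ᵐ[expMeasure 1] fun l : ℝ => l := ae_expMeasure_pos.mono fun l hl => hl.le
  refine ⟨measurable_id.aestronglyMeasurable, ?_⟩
  rw [hasFiniteIntegral_iff_ofReal hnn, lintegral_eq_lintegral_meas_lt _ hnn measurable_id.aemeasurable]
  have h : ∀ t ∈ Ioi (0 : ℝ), expMeasure 1 {l | t < l} = ENNReal.ofReal (Real.exp (-1 * t)) := by
    intro t ht
    rw [neg_one_mul, ← expMeasure_real_Ioi (le_of_lt ht), ofReal_measureReal]
    rfl
  rw [setLIntegral_congr_fun measurableSet_Ioi h]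
  have := (exp_neg_integrableOn_Ioi 0 one_pos).2
  rwa [hasFiniteIntegral_iff_ofReal (Eventually.of_forall fun t => by positivity)] at this

theorem integral_id_expMeasure : ∫ l, l ∂expMeasure 1 = 1 := by
  have hnn : 0 ≤ᵐ[expMeasure 1] fun l : ℝ => l := ae_expMeasure_pos.mono fun l hl => hl.le
  rw [integrable_id_expMeasure.integral_eq_integral_meas_lt hnn]
  have h : ∀ t ∈ Ioi (0 : ℝ), (expMeasure 1).real {l | t < l} = Real.exp (-t) := by
    intro t ht
    rw [← expMeasure_real_Ioi (le_of_lt ht)]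
    rfl
  rw [setIntegral_congr_fun measurableSet_Ioi h, integral_exp_neg_Ioi_zero]

theorem integrable_min_expMeasure (s : ℝ) :
    Integrable (fun l : ℝ => min l s) (expMeasure 1) :=
  integrable_id_expMeasure.inf (integrable_const s)

/-- Both sides are `1 - exp (-s)`. This is the compensator identity of a clock stopped at `s`: mean
elapsed time equals the probability of ringing. It keeps the martingale property when time is cut at
`t`. -/
theorem integral_min_expMeasure {s : ℝ} (hs : 0 ≤ s) :
    ∫ l, min l s ∂expMeasure 1 = (expMeasure 1).real (Iic s) := by
  have hnn : 0 ≤ᵐ[expMeasure 1] fun l : ℝ => min l s :=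
    ae_expMeasure_pos.mono fun l hl => le_min hl.le hs
  rw [(integrable_min_expMeasure s).integral_eq_integral_meas_lt hnn]
  have h : ∀ t ∈ Ioi (0 : ℝ), (expMeasure 1).real {l | t < min l s} =
      (Iio s).indicator (fun t => Real.exp (-t)) t := by
    intro t ht
    by_cases hts : t < s
    · rw [indicator_of_mem (mem_Iio.2 hts), ← expMeasure_real_Ioi (le_of_lt ht)]
      congr 1
      ext l
      simp [hts]
    · rw [indicator_of_notMem (by simpa using hts)]
      simp [hts]
  rw [setIntegral_congr_fun measurableSet_Ioi h, setIntegral_indicator measurableSet_Iio,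
    Ioi_inter_Iio, ← integral_Ioc_eq_integral_Ioo, ← intervalIntegral.integral_of_le hs,
    expMeasure_real_Iic hs]
  simp

end Exponential

/-! ### Almost sure bounds on the clocks -/

section Clock

variable {Ω : Type*} [mΩ : MeasurableSpace Ω] {P : Measure Ω} {lam : ℕ → Ω → ℝ}

theorem ae_lam_pos (h : IsExpSequence P lam) : ∀ᵐ ω ∂P, ∀ n, 0 < lam n ω := by
  rw [ae_all_iff]
  intro n
  have := ae_expMeasure_pos
  rw [← h.law n] at this
  exact ae_of_ae_map (h.measurable n).aemeasurable this

theorem measure_lam_preimage (h : IsExpSequence P lam) (n : ℕ) {s : Set ℝ} (hs : MeasurableSet s) :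
    P (lam n ⁻¹' s) = expMeasure 1 s := by
  rw [← h.law n, Measure.map_apply (h.measurable n) hs]

theorem ae_eventually_lam_le (h : IsExpSequence P lam) :
    ∀ᵐ ω ∂P, ∀ᶠ n : ℕ in atTop, lam n ω ≤ n := by
  have hsum : ∑' n : ℕ, P (lam n ⁻¹' Ioi (n : ℝ)) ≠ ∞ := by
    have h1 (n : ℕ) : P (lam n ⁻¹' Ioi (n : ℝ)) = ENNReal.ofReal (Real.exp (-n)) := by
      rw [measure_lam_preimage h n measurableSet_Ioi, ← expMeasure_real_Ioi n.cast_nonneg,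
        ofReal_measureReal]
    simp_rw [h1]
    exact Real.summable_exp_neg_nat.tsum_ofReal_ne_top
  filter_upwards [ae_eventually_notMem hsum] with ω hω
  filter_upwards [hω] with n hn
  simpa using hn

/-- Borel–Cantelli: the probability of `lam n ≤ s` is at most `s`, and the thresholds are summable.
-/
theorem ae_eventually_le_lam (h : IsExpSequence P lam) :
    ∀ᵐ ω ∂P, ∀ᶠ n : ℕ in atTop, 1 / ((n : ℝ) + 1) ^ 2 ≤ lam n ω := by
  have hsum : ∑' n : ℕ, P (lam n ⁻¹' Iic (1 / ((n : ℝ) + 1) ^ 2)) ≠ ∞ := by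
    have h1 (n : ℕ) : P (lam n ⁻¹' Iic (1 / ((n : ℝ) + 1) ^ 2)) ≤
        ENNReal.ofReal (1 / ((n : ℝ) + 1) ^ 2) := by
      rw [measure_lam_preimage h n measurableSet_Iic, ← ofReal_measureReal,
        expMeasure_real_Iic (by positivity)]
      refine ENNReal.ofReal_le_ofReal ?_
      linarith [Real.add_one_le_exp (-(1 / ((n : ℝ) + 1) ^ 2))]
    refine ne_top_of_le_ne_top ?_ (ENNReal.tsum_le_tsum h1)
    have := (summable_nat_add_iff 1).2 (Real.summable_one_div_nat_pow.2 one_lt_two)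
    refine Summable.tsum_ofReal_ne_top ?_
    simpa using this
  filter_upwards [ae_eventually_notMem hsum] with ω hω
  filter_upwards [hω] with n hn
  exact le_of_lt (by simpa using hn)

/-- Eventually the clocks lie between two powers of `n`, up to shifts, so they do not affect
exponential growth rates. -/
theorem ae_tendsto_log_lam (h : IsExpSequence P lam) :
    ∀ᵐ ω ∂P, Tendsto (fun n : ℕ => Real.log (lam n ω) / n) atTop (𝓝 0) := by
  have h1 : Tendsto (fun n : ℕ => Real.log ((n : ℝ) + 1) / n) atTop (𝓝 0) := by
    have h2 : Tendsto (fun x : ℝ => Real.log x / x) atTop (𝓝 0) :=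
      Real.isLittleO_log_id_atTop.tendsto_div_nhds_zero
    have h3 := (h2.comp (tendsto_atTop_add_const_right _ 1 tendsto_natCast_atTop_atTop)).const_mul
      (2 : ℝ)
    rw [mul_zero] at h3
    refine tendsto_of_tendsto_of_tendsto_of_le_of_le' tendsto_const_nhds h3 ?_ ?_
    · filter_upwards with n
      have : 0 ≤ Real.log ((n : ℝ) + 1) := Real.log_nonneg (by simp)
      positivity
    · filter_upwards [eventually_ge_atTop 1] with n hn
      have hn' : (1 : ℝ) ≤ n := by exact_mod_cast hn
      have : 0 ≤ Real.log ((n : ℝ) + 1) := Real.log_nonneg (by simp)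
      simp only [Function.comp]
      rw [← mul_div_assoc, div_le_div_iff₀ (by positivity) (by positivity)]
      nlinarith
  filter_upwards [ae_eventually_lam_le h, ae_eventually_le_lam h] with ω hu hl
  refine tendsto_of_tendsto_of_tendsto_of_le_of_le' (g := fun n : ℕ => -2 * (Real.log ((n : ℝ) + 1) / n))
    (by simpa using h1.const_mul (-2)) h1 ?_ ?_
  · filter_upwards [hl] with n hn
    rw [← mul_div_assoc]
    gcongr
    have := Real.log_le_log (by positivity) hn
    rw [Real.log_div one_ne_zero (by positivity), Real.log_one, Real.log_pow] at this
    push_cast at this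
    linarith
  · filter_upwards [hu, hl] with n hn hn'
    gcongr
    · exact lt_of_lt_of_le (by positivity) hn'
    · linarith

end Clock

/-! ### The joint filtration of chain and clocks -/

section Past

variable {Ω : Type*}

/-- The information carried by the first `n + 1` states and the first `n` clocks. -/
@[reducible] def past (κ : ℕ → Ω → E3) (lam : ℕ → Ω → ℝ) (n : ℕ) : MeasurableSpace Ω :=
  chainPast κ n ⊔ ⨆ j < n, MeasurableSpace.comap (lam j) inferInstance

theorem measurable_past_chain (κ : ℕ → Ω → E3) (lam : ℕ → Ω → ℝ) {j n : ℕ} (hj : j ≤ n) :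
    Measurable[past κ lam n] (κ j) :=
  (measurable_chainPast κ hj).mono le_sup_left le_rfl

theorem measurable_past_lam (κ : ℕ → Ω → E3) (lam : ℕ → Ω → ℝ) {j n : ℕ} (hj : j < n) :
    Measurable[past κ lam n] (lam j) :=
  Measurable.of_comap_le (le_sup_of_le_right (le_iSup₂_of_le (f := fun j (_ : j < n) =>
    MeasurableSpace.comap (lam j) inferInstance) j hj le_rfl))

variable [mΩ : MeasurableSpace Ω] {P : Measure Ω} {κ : ℕ → Ω → E3} {lam : ℕ → Ω → ℝ}

theorem past_le (hκ : ∀ n, Measurable (κ n)) (hl : ∀ n, Measurable (lam n)) (n : ℕ) :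
    past κ lam n ≤ mΩ :=
  sup_le (chainPast_le hκ n) (iSup₂_le fun j _ => (hl j).comap_le)

/-- The filtration of the pair formed by a chain and its clocks. -/
def pastFiltration (hκ : ∀ n, Measurable (κ n)) (hl : ∀ n, Measurable (lam n)) :
    Filtration ℕ mΩ where
  seq := past κ lam
  mono' _ _ hij := sup_le_sup
    (biSup_mono fun _ h => le_trans h hij) (biSup_mono fun _ h => lt_of_lt_of_le h hij)
  le' := past_le hκ hl

/-- The `n`-th clock is excluded from `past` because it measures the stay in state `n`; with the
next direction it forms the innovation. Independence of chain and clocks, and of present and past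
within each, is regrouped by `indep_sup_sup`. -/
theorem past_indep [IsProbabilityMeasure P] {a : ℝ} {k : E3} (ha1 : a < 1) (hk : k ≠ 0)
    (hκ : IsMarkovChainFrom (fun y => unif.map (step a y)) k P κ) (hl : IsExpSequence P lam)
    (hind : IndepFun (fun ω n => κ n ω) (fun ω n => lam n ω) P) (n : ℕ) :
    P.map (fun ω => (jumpDir a (κ n ω) (κ (n + 1) ω), lam n ω)) = unif.prod (expMeasure 1) ∧
    Indep (past κ lam n) (MeasurableSpace.comap
      (fun ω => (jumpDir a (κ n ω) (κ (n + 1) ω), lam n ω)) inferInstance) P := by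
  have hU : Measurable[chainPast κ (n + 1)] fun ω => jumpDir a (κ n ω) (κ (n + 1) ω) := by
    have h1 := measurable_chainPast κ n.le_succ
    have h2 := measurable_chainPast κ (le_refl (n + 1))
    fun_prop
  have hU' := hU.mono (chainPast_le hκ.measurable _) le_rfl
  obtain ⟨hlaw, hindU⟩ := indep_chainPast_jumpDir ha1 hk hκ n
  rw [IndepFun_iff_Indep] at hind
  have hle1 : chainPast κ (n + 1) ≤ MeasurableSpace.comap (fun ω n => κ n ω) inferInstance := by
    refine iSup₂_le fun j _ => Measurable.comap_le ?_
    exact (measurable_pi_apply j).comp (comap_measurable fun ω n => κ n ω)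
  have hle2 (j : ℕ) : MeasurableSpace.comap (lam j) inferInstance ≤
      MeasurableSpace.comap (fun ω n => lam n ω) inferInstance :=
    Measurable.comap_le ((measurable_pi_apply j).comp (comap_measurable fun ω n => lam n ω))
  have hbig := indep_of_indep_of_le_left (indep_of_indep_of_le_right hind
    (sup_le (iSup₂_le fun j (_ : j < n) => hle2 j) (hle2 n)))
    (sup_le ((biSup_mono fun j hj => le_trans hj n.le_succ : chainPast κ n ≤ _).trans hle1)
      (hU.comap_le.trans hle1))
  have hlam : Indep (⨆ j < n, MeasurableSpace.comap (lam j) inferInstance)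
      (MeasurableSpace.comap (lam n) inferInstance) P := by
    have := indep_iSup_of_disjoint (fun j => (hl.measurable j).comap_le) hl.indep
      (S := {j | j < n}) (T := {n}) (by simp)
    simpa using this
  refine ⟨?_, ?_⟩
  · have h2 : IndepFun (fun ω => jumpDir a (κ n ω) (κ (n + 1) ω)) (lam n) P := by
      rw [IndepFun_iff_Indep]
      exact indep_of_indep_of_le_left (indep_of_indep_of_le_right hbig le_sup_right) le_sup_right
    rw [(indepFun_iff_map_prod_eq_prod_map_map hU'.aemeasurable (hl.measurable n).aemeasurable).1 h2,
      hlaw, hl.law]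
  · have hc : MeasurableSpace.comap (fun ω => (jumpDir a (κ n ω) (κ (n + 1) ω), lam n ω))
        inferInstance = _ := MeasurableSpace.comap_prodMk _ _
    rw [hc]
    exact indep_sup_sup (chainPast_le hκ.measurable n) hU'.comap_le
      (iSup₂_le fun j _ => (hl.measurable j).comap_le) (hl.measurable n).comap_le hindU hlam hbig

end Past

/-! ### Exponential growth of partial sums -/

section Growth

variable {τ : ℕ → ℝ} {γ : ℝ}

/-- Partial sums of a sequence with positive exponential growth rate have the same growth rate. -/
theorem tendsto_log_sum_range_div (hτ : ∀ n, 0 < τ n) (hγ : 0 < γ)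
    (h : Tendsto (fun n : ℕ => Real.log (τ n) / n) atTop (𝓝 γ)) :
    Tendsto (fun n : ℕ => Real.log (∑ j ∈ Finset.range n, τ j) / n) atTop (𝓝 γ) := by
  rw [tendsto_order]
  constructor
  · intro b hb
    -- Lower bound: the sum of the first `n + 1` terms is at least `τ n`; the index shift costs a
    -- factor `n / (n + 1)`.
    have h1 := h.mul (tendsto_natCast_div_add_atTop (1 : ℝ))
    rw [mul_one] at h1
    rw [← map_add_atTop_eq_nat 1, eventually_map]
    filter_upwards [(tendsto_order.1 h1).1 b hb, eventually_gt_atTop 0] with n hn hn0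
    have hn0 : (0 : ℝ) < n := by exact_mod_cast hn0
    refine hn.trans_le ?_
    rw [div_mul_div_cancel₀ hn0.ne']
    push_cast
    gcongr
    · exact hτ n
    · exact Finset.single_le_sum (f := τ) (fun i _ => (hτ i).le) (Finset.self_mem_range_succ n)
  · intro b hb
    -- Upper bound: with a rate `d` strictly between `γ` and `b`, the sum is at most `n * C * exp (d
    -- * n)`, and the factor `n * C` is lost in the slack.
    obtain ⟨d, hd, hdb⟩ := exists_between hb
    have hd0 : 0 < d := hγ.trans hd
    have hev : ∀ᶠ n : ℕ in atTop, τ n ≤ Real.exp (d * n) := by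
      filter_upwards [(tendsto_order.1 h).2 d hd, eventually_gt_atTop 0] with n hn hn0
      have hn0 : (0 : ℝ) < n := by exact_mod_cast hn0
      rw [div_lt_iff₀ hn0] at hn
      exact (Real.log_le_iff_le_exp (hτ n)).1 hn.le
    obtain ⟨n₀, hn₀⟩ := eventually_atTop.1 hev
    -- The summand `1` serves the indices from `n₀` on; the finite sum dominates the earlier terms.
    set C := 1 + ∑ j ∈ Finset.range n₀, τ j with hC
    have hsum0 : 0 ≤ ∑ j ∈ Finset.range n₀, τ j := Finset.sum_nonneg fun j _ => (hτ j).le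
    have hC1 : 1 ≤ C := by linarith
    have hall (j : ℕ) : τ j ≤ C * Real.exp (d * j) := by
      have he : 1 ≤ Real.exp (d * j) := Real.one_le_exp (by positivity)
      by_cases hj : n₀ ≤ j
      · nlinarith [hn₀ j hj]
      · have := Finset.single_le_sum (f := τ) (fun i _ => (hτ i).le)
          (Finset.mem_range.2 (not_le.1 hj))
        nlinarith
    have hT (n : ℕ) : ∑ j ∈ Finset.range n, τ j ≤ n * (C * Real.exp (d * n)) := by
      calc _ ≤ ∑ j ∈ Finset.range n, C * Real.exp (d * n) := by
            refine Finset.sum_le_sum fun j hj => (hall j).trans ?_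
            have : (j : ℝ) ≤ n := by exact_mod_cast (Finset.mem_range.1 hj).le
            gcongr
        _ = _ := by simp
    have hlim : Tendsto (fun n : ℕ => Real.log n / n + Real.log C / n + d) atTop (𝓝 d) := by
      have h2 : Tendsto (fun n : ℕ => Real.log n / n) atTop (𝓝 0) :=
        (Real.isLittleO_log_id_atTop.tendsto_div_nhds_zero).comp tendsto_natCast_atTop_atTop
      simpa using (h2.add (tendsto_const_div_atTop_nhds_zero_nat (Real.log C))).add_const d
    filter_upwards [(tendsto_order.1 hlim).2 b hdb, eventually_gt_atTop 0] with n hn hn0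
    refine lt_of_le_of_lt ?_ hn
    have hn0' : (0 : ℝ) < n := by exact_mod_cast hn0
    have hpos : 0 < ∑ j ∈ Finset.range n, τ j :=
      Finset.sum_pos (fun j _ => hτ j) ⟨0, Finset.mem_range.2 hn0⟩
    have := Real.log_le_log hpos (hT n)
    rw [Real.log_mul hn0'.ne' (by positivity), Real.log_mul (by positivity) (by positivity),
      Real.log_exp] at this
    rw [div_le_iff₀ hn0']
    have e : (Real.log n / n + Real.log C / n + d) * n = Real.log n + Real.log C + d * n := by
      field_simp
    linarith

end Growth

/-! ### Inverting the jump times -/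

section Counting

variable {T : ℕ → ℝ}

/-- The number of terms `T 1, T 2, …` of an increasing sequence which are at most `t`. -/
def countUpTo (T : ℕ → ℝ) (t : ℝ) : ℕ := sSup {n | T n ≤ t}

theorem bddAbove_countUpTo (hT : Tendsto T atTop atTop) (t : ℝ) : BddAbove {n | T n ≤ t} := by
  obtain ⟨n₀, hn₀⟩ := eventually_atTop.1 (hT.eventually_gt_atTop t)
  exact ⟨n₀, fun n hn => not_lt.1 fun h => not_le.2 (hn₀ n h.le) hn⟩

theorem le_countUpTo_iff (hmono : StrictMono T) (h0 : T 0 = 0) (hT : Tendsto T atTop atTop) {t : ℝ}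
    (ht : 0 ≤ t) {n : ℕ} : n ≤ countUpTo T t ↔ T n ≤ t := by
  constructor
  · intro h
    have hmem : countUpTo T t ∈ {n | T n ≤ t} :=
      Nat.sSup_mem ⟨0, by simpa [h0] using ht⟩ (bddAbove_countUpTo hT t)
    exact (hmono.monotone h).trans hmem
  · exact fun h => le_csSup (bddAbove_countUpTo hT t) h

theorem countUpTo_eq (hmono : StrictMono T) (h0 : T 0 = 0) (hT : Tendsto T atTop atTop) {t : ℝ}
    {n : ℕ} (h1 : T n ≤ t) (h2 : t < T (n + 1)) : countUpTo T t = n := by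
  have ht : 0 ≤ t := by
    have := hmono.monotone n.zero_le
    linarith
  refine le_antisymm (Nat.lt_succ_iff.1 (not_le.1 fun h => ?_))
    ((le_countUpTo_iff hmono h0 hT ht).2 h1)
  exact not_lt.2 ((le_countUpTo_iff hmono h0 hT ht).1 h) h2

theorem tendsto_countUpTo (hmono : StrictMono T) (h0 : T 0 = 0) (hT : Tendsto T atTop atTop) :
    Tendsto (countUpTo T) atTop atTop := by
  refine tendsto_atTop.2 fun n => ?_
  filter_upwards [eventually_ge_atTop (T n), eventually_ge_atTop 0] with t ht ht0
  exact (le_countUpTo_iff hmono h0 hT ht0).2 ht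

/-- With `N = countUpTo T t` one has `T N ≤ t < T (N + 1)`, and both bounds have logarithm
asymptotic to `γ * N`. -/
theorem tendsto_log_div_countUpTo {γ : ℝ} (hmono : StrictMono T) (h0 : T 0 = 0)
    (hT : Tendsto T atTop atTop)
    (hlog : Tendsto (fun n : ℕ => Real.log (T n) / n) atTop (𝓝 γ)) :
    Tendsto (fun t : ℝ => Real.log t / countUpTo T t) atTop (𝓝 γ) := by
  have hN := tendsto_countUpTo hmono h0 hT
  have hlow := hlog.comp hN
  have hup : Tendsto (fun n : ℕ => Real.log (T (n + 1)) / n) atTop (𝓝 γ) := by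
    have h1 := (hlog.comp (tendsto_add_atTop_nat 1)).mul
      (tendsto_const_nhds.add (tendsto_one_div_atTop_nhds_zero_nat (𝕜 := ℝ)) :
        Tendsto (fun n : ℕ => (1 : ℝ) + 1 / n) atTop (𝓝 (1 + 0)))
    rw [add_zero, mul_one] at h1
    refine h1.congr' ?_
    filter_upwards [eventually_gt_atTop 0] with n hn
    have hn : (0 : ℝ) < n := by exact_mod_cast hn
    simp only [Function.comp]
    push_cast
    field_simp
  refine tendsto_of_tendsto_of_tendsto_of_le_of_le' hlow (hup.comp hN) ?_ ?_
  · filter_upwards [eventually_ge_atTop 0, hN.eventually_gt_atTop 0] with t ht hpos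
    simp only [Function.comp]
    have hTpos : 0 < T (countUpTo T t) := h0 ▸ hmono hpos
    have hle := (le_countUpTo_iff hmono h0 hT ht).1 le_rfl
    gcongr
  · filter_upwards [eventually_gt_atTop 0] with t ht
    simp only [Function.comp]
    have hlt : t < T (countUpTo T t + 1) := by
      refine not_le.1 fun h => ?_
      exact absurd ((le_countUpTo_iff hmono h0 hT ht.le).2 h) (by omega)
    gcongr

end Counting

/-! ### Decay of the momentum along a typical trajectory -/

section Path

/-- The time spent in the `n`-th state. -/
def holdTime (c : ℝ) (κ : ℕ → E3) (l : ℕ → ℝ) (n : ℕ) : ℝ := l n / (c * ‖κ n‖)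

/-- The time of the `n`-th jump. -/
def realJumpTime (c : ℝ) (κ : ℕ → E3) (l : ℕ → ℝ) (n : ℕ) : ℝ :=
  ∑ j ∈ Finset.range n, holdTime c κ l j

/-- The asymptotic properties that almost every trajectory of the chain and its clocks has. -/
structure IsTypical (κ : ℕ → E3) (l : ℕ → ℝ) (γ : ℝ) : Prop where
  ne_zero : ∀ n, κ n ≠ 0
  clock_pos : ∀ n, 0 < l n
  rate_pos : 0 < γ
  log_norm : Tendsto (fun n : ℕ => Real.log ‖κ n‖ / n) atTop (𝓝 (-γ))
  log_clock : Tendsto (fun n : ℕ => Real.log (l n) / n) atTop (𝓝 0)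

variable {c γ : ℝ} {κ : ℕ → E3} {l : ℕ → ℝ}

theorem realJumpTime_zero : realJumpTime c κ l 0 = 0 := by simp [realJumpTime]

theorem realJumpTime_succ (n : ℕ) :
    realJumpTime c κ l (n + 1) = realJumpTime c κ l n + holdTime c κ l n :=
  Finset.sum_range_succ _ _

theorem IsTypical.holdTime_pos (h : IsTypical κ l γ) (hc : 0 < c) (n : ℕ) :
    0 < holdTime c κ l n :=
  div_pos (h.clock_pos n) (mul_pos hc (norm_pos_iff.2 (h.ne_zero n)))

theorem IsTypical.strictMono (h : IsTypical κ l γ) (hc : 0 < c) :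
    StrictMono (realJumpTime c κ l) :=
  strictMono_nat_of_lt_succ fun n => by
    rw [realJumpTime_succ]; linarith [h.holdTime_pos hc n]

theorem IsTypical.log_realJumpTime (h : IsTypical κ l γ) (hc : 0 < c) :
    Tendsto (fun n : ℕ => Real.log (realJumpTime c κ l n) / n) atTop (𝓝 γ) := by
  refine tendsto_log_sum_range_div (h.holdTime_pos hc) h.rate_pos ?_
  have h1 := (h.log_clock.sub (tendsto_const_div_atTop_nhds_zero_nat (Real.log c))).sub h.log_norm
  rw [sub_zero, zero_sub, neg_neg] at h1
  refine h1.congr fun n => ?_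
  have := norm_ne_zero_iff.2 (h.ne_zero n)
  rw [holdTime, Real.log_div (h.clock_pos n).ne' (mul_ne_zero hc.ne' this),
    Real.log_mul hc.ne' this]
  ring

theorem IsTypical.tendsto_realJumpTime (h : IsTypical κ l γ) (hc : 0 < c) :
    Tendsto (realJumpTime c κ l) atTop atTop := by
  have h1 := (h.log_realJumpTime hc).pos_mul_atTop h.rate_pos tendsto_natCast_atTop_atTop
  refine (Real.tendsto_exp_atTop.comp h1).congr' ?_
  filter_upwards [eventually_gt_atTop 0] with n hn
  have hn' : (n : ℝ) ≠ 0 := by positivity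
  have hpos : 0 < realJumpTime c κ l n := by
    rw [← realJumpTime_zero (c := c) (κ := κ) (l := l)]; exact h.strictMono hc hn
  simp only [Function.comp]
  rw [div_mul_cancel₀ _ hn', Real.exp_log hpos]

theorem IsTypical.exists_norm_eq_rpow (h : IsTypical κ l γ) (hc : 0 < c) :
    ∃ ε : ℝ → ℝ, Tendsto ε atTop (𝓝 0) ∧ ∀ᶠ t : ℝ in atTop,
      ‖κ (countUpTo (realJumpTime c κ l) t)‖ = ‖κ 0‖ * t ^ (-1 + ε t) := by
  set N := countUpTo (realJumpTime c κ l)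
  have hT := h.tendsto_realJumpTime hc
  have hmono := h.strictMono hc
  have hN : Tendsto N atTop atTop := tendsto_countUpTo hmono realJumpTime_zero hT
  have hlog : Tendsto (fun t : ℝ => Real.log t / N t) atTop (𝓝 γ) :=
    tendsto_log_div_countUpTo hmono realJumpTime_zero hT (h.log_realJumpTime hc)
  -- The exponent error is `ε t = 1 + (log ‖κ N‖ - log ‖κ 0‖) / log t`. Numerator and denominator
  -- are both divided by `N`, with limits `-γ` and `γ`.
  have hlim := (((h.log_norm.sub (tendsto_const_div_atTop_nhds_zero_nat (Real.log ‖κ 0‖))).comp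
    hN).div hlog h.rate_pos.ne').add_const 1
  rw [sub_zero, neg_div, div_self h.rate_pos.ne', neg_add_cancel] at hlim
  refine ⟨_, hlim, ?_⟩
  filter_upwards [eventually_gt_atTop 1, hN.eventually_gt_atTop 0] with t ht hpos
  have ht0 : 0 < t := one_pos.trans ht
  have hN0 : (N t : ℝ) ≠ 0 := by positivity
  have hl0 : Real.log t ≠ 0 := (Real.log_pos ht).ne'
  have h1 := norm_pos_iff.2 (h.ne_zero (N t))
  have h2 := norm_pos_iff.2 (h.ne_zero 0)
  rw [Real.rpow_def_of_pos ht0]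
  have hexp : Real.log t * (-1 + ((((fun n : ℕ => Real.log ‖κ n‖ / n - Real.log ‖κ 0‖ / n) ∘ N) /
      fun t => Real.log t / N t) t + 1)) = Real.log ‖κ (N t)‖ - Real.log ‖κ 0‖ := by
    simp only [Pi.div_apply, Function.comp]
    field_simp
    ring
  rw [hexp, Real.exp_sub, Real.exp_log h1, Real.exp_log h2, mul_div_cancel₀ _ h2.ne']

theorem jumpTime_eq_ofReal {Ω : Type*} {m M : ℝ} (hm : 0 < m) (hM : 0 < M) {κ : ℕ → Ω → E3}
    {lam : ℕ → Ω → ℝ} {ω : Ω} (h : IsTypical (fun n => κ n ω) (fun n => lam n ω) γ) (n : ℕ) :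
    jumpTime m M κ lam n ω = ENNReal.ofReal
      (realJumpTime (rateConst m M) (fun n => κ n ω) (fun n => lam n ω) n) := by
  rw [jumpTime, realJumpTime, ENNReal.ofReal_sum_of_nonneg
    fun j _ => (h.holdTime_pos (rateConst_pos hm hM) j).le]
  refine Finset.sum_congr rfl fun j _ => ?_
  rw [scatteringRate_eq hm hM, holdTime, ENNReal.ofReal_div_of_pos]
  exact mul_pos (rateConst_pos hm hM) (norm_pos_iff.2 (h.ne_zero j))

theorem jumpCount_eq_countUpTo {Ω : Type*} {m M : ℝ} (hm : 0 < m) (hM : 0 < M) {κ : ℕ → Ω → E3}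
    {lam : ℕ → Ω → ℝ} {ω : Ω} (h : IsTypical (fun n => κ n ω) (fun n => lam n ω) γ) {t : ℝ}
    (ht : 0 ≤ t) :
    jumpCount m M κ lam t ω = countUpTo
      (realJumpTime (rateConst m M) (fun n => κ n ω) (fun n => lam n ω)) t := by
  rw [jumpCount, countUpTo]
  congr 1
  ext n
  rw [mem_ofPred_eq, mem_ofPred_eq, jumpTime_eq_ofReal hm hM h, ENNReal.ofReal_le_ofReal_iff ht]

end Path

/-! ### The displacement as a sum over jumps -/

section Displacement

/-- The displacement up to time `t ∧ T n` of a particle of mass `m` which has momentum `κ j` in the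
time interval `[T j, T (j + 1))`. -/
def displacement (m : ℝ) (T : ℕ → ℝ) (κ : ℕ → E3) (t : ℝ) (n : ℕ) : E3 :=
  ∑ j ∈ Finset.range n, (m⁻¹ * (min (T (j + 1)) t - min (T j) t)) • κ j

variable {m : ℝ} {T : ℕ → ℝ} {κ : ℕ → E3} {t : ℝ}

theorem norm_displacement_le (hm : 0 < m) (hmono : Monotone T) (h0 : T 0 = 0) (ht : 0 ≤ t) {r : ℝ}
    (hκ : ∀ n, ‖κ n‖ ≤ r) (n : ℕ) : ‖displacement m T κ t n‖ ≤ m⁻¹ * t * r := by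
  have hr : 0 ≤ r := (norm_nonneg _).trans (hκ 0)
  calc ‖displacement m T κ t n‖
      ≤ ∑ j ∈ Finset.range n, (m⁻¹ * (min (T (j + 1)) t - min (T j) t)) * r := by
        refine (norm_sum_le _ _).trans (Finset.sum_le_sum fun j _ => ?_)
        have h1 : 0 ≤ min (T (j + 1)) t - min (T j) t :=
          sub_nonneg.2 (min_le_min_right t (hmono j.le_succ))
        rw [norm_smul, Real.norm_of_nonneg (by positivity)]
        gcongr
        exact hκ j
    _ = m⁻¹ * min (T n) t * r := by
        rw [← Finset.sum_mul, ← Finset.mul_sum, Finset.sum_range_sub (fun j => min (T j) t), h0,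
          min_eq_left ht, sub_zero]
    _ ≤ m⁻¹ * t * r := by gcongr; exact min_le_right _ _

theorem countUpTo_of_mem_Ioo (hmono : StrictMono T) (h0 : T 0 = 0) (hT : Tendsto T atTop atTop)
    {j : ℕ} {s : ℝ} (h1 : min (T j) t < s) (h2 : s < min (T (j + 1)) t) : countUpTo T s = j := by
  obtain ⟨h3, h4⟩ := lt_min_iff.1 h2
  refine countUpTo_eq hmono h0 hT ?_ h3
  rcases min_lt_iff.1 h1 with h | h
  · exact h.le
  · exact absurd h h4.not_gt

/-- At the right endpoint the count may already have moved on; a single point is null for the time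
integral. -/
theorem ae_eq_of_uIoc (hmono : StrictMono T) (h0 : T 0 = 0) (hT : Tendsto T atTop atTop) (j : ℕ) :
    ∀ᵐ s : ℝ, s ∈ uIoc (min (T j) t) (min (T (j + 1)) t) →
      m⁻¹ • κ (countUpTo T s) = m⁻¹ • κ j := by
  have hne : ∀ᵐ s : ℝ, s ≠ min (T (j + 1)) t := by
    rw [ae_iff]; simp
  filter_upwards [hne] with s hs hmem
  rw [uIoc_of_le (min_le_min_right t (hmono.monotone j.le_succ))] at hmem
  rw [countUpTo_of_mem_Ioo hmono h0 hT hmem.1 (lt_of_le_of_ne hmem.2 hs)]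

theorem integral_eq_displacement (hmono : StrictMono T) (h0 : T 0 = 0) (hT : Tendsto T atTop atTop)
    (ht : 0 ≤ t) {n : ℕ} (hn : t ≤ T n) :
    ∫ s in (0 : ℝ)..t, m⁻¹ • κ (countUpTo T s) = displacement m T κ t n := by
  have hint (j : ℕ) : IntervalIntegrable (fun s => m⁻¹ • κ (countUpTo T s)) volume
      (min (T j) t) (min (T (j + 1)) t) := by
    refine (intervalIntegrable_const (c := m⁻¹ • κ j)).congr_ae ?_
    rw [EventuallyEq, ae_restrict_iff' measurableSet_uIoc]
    filter_upwards [ae_eq_of_uIoc (m := m) (κ := κ) hmono h0 hT j] with s hs hmem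
    exact (hs hmem).symm
  have hsum := intervalIntegral.sum_integral_adjacent_intervals (a := fun j => min (T j) t)
    (n := n) (fun j _ => hint j)
  rw [h0, min_eq_left ht, min_eq_right hn] at hsum
  rw [← hsum, displacement]
  refine Finset.sum_congr rfl fun j _ => ?_
  rw [intervalIntegral.integral_congr_ae (ae_eq_of_uIoc hmono h0 hT j),
    intervalIntegral.integral_const, smul_smul, mul_comm]

/-- The indices with `T (j + 1) ≤ t` are exactly those below `countUpTo T t`, so the sum telescopes
and stops there. -/
theorem sum_indicator_sub (hmono : StrictMono T) (h0 : T 0 = 0) (hT : Tendsto T atTop atTop)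
    (ht : 0 ≤ t) (f : ℕ → ℝ) (n : ℕ) :
    ∑ j ∈ Finset.range n, (if T (j + 1) ≤ t then 1 else 0) * (f (j + 1) - f j) =
      f (min n (countUpTo T t)) - f 0 := by
  induction n with
  | zero => simp
  | succ n ih =>
    rw [Finset.sum_range_succ, ih]
    by_cases h : T (n + 1) ≤ t
    · have h1 := (le_countUpTo_iff hmono h0 hT ht).2 h
      rw [if_pos h, min_eq_left (by omega), min_eq_left h1]
      ring
    · have h1 : countUpTo T t ≤ n := by
        by_contra h2
        exact h ((le_countUpTo_iff hmono h0 hT ht).1 (by omega))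
      rw [if_neg h, min_eq_right h1, min_eq_right (by omega)]
      ring

end Displacement

/-! ### One step of the martingale -/

section Increment

/-- The increment of the (coordinates of the) martingale `X + H K / |K|` during one step, where `A`
is the rescaled time spent in the current state, and `B` indicates whether the particle jumps. -/
def increment (m c a : ℝ) (A B : E3 × ℝ → ℝ → ℝ) (i : Fin 3) (p : (E3 × ℝ) × (E3 × ℝ)) : ℝ :=
  (m * c)⁻¹ * A p.1 p.2.2 * dir p.1.1 i +
    B p.1 p.2.2 * ((m * c * (1 - dirCorr a))⁻¹ * (dir (step a p.1.1 p.2.1) i - dir p.1.1 i))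

variable {m c a : ℝ} {A B : E3 × ℝ → ℝ → ℝ}

theorem abs_apply_le_norm (v : E3) (i : Fin 3) : |v i| ≤ ‖v‖ := by
  simpa using PiLp.norm_apply_le v i

theorem measurable_increment (hA : Measurable (Function.uncurry A))
    (hB : Measurable (Function.uncurry B)) (i : Fin 3) : Measurable (increment m c a A B i) := by
  have hA' : Measurable fun p : (E3 × ℝ) × (E3 × ℝ) => A p.1 p.2.2 :=
    hA.comp (measurable_fst.prodMk (measurable_snd.comp measurable_snd))
  have hB' : Measurable fun p : (E3 × ℝ) × (E3 × ℝ) => B p.1 p.2.2 :=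
    hB.comp (measurable_fst.prodMk (measurable_snd.comp measurable_snd))
  unfold increment
  fun_prop

theorem abs_increment_le (hm : 0 < m) (hc : 0 < c) (ha1 : a < 1) (i : Fin 3) {y : E3 × ℝ}
    {u : E3} {l : ℝ} (hAl : |A y l| ≤ l) (hBl : |B y l| ≤ 1) :
    |increment m c a A B i (y, (u, l))| ≤
      (m * c)⁻¹ * l + 2 * (m * c * (1 - dirCorr a))⁻¹ := by
  have hH : 0 < (m * c * (1 - dirCorr a))⁻¹ :=
    inv_pos.2 (mul_pos (mul_pos hm hc) (sub_pos.2 (dirCorr_lt_one ha1)))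
  have h1 := (abs_apply_le_norm (dir y.1) i).trans (norm_dir_le y.1)
  have h2 := (abs_apply_le_norm (dir (step a y.1 u)) i).trans (norm_dir_le (step a y.1 u))
  have hmc : 0 < (m * c)⁻¹ := by positivity
  rw [increment]
  refine (abs_add_le _ _).trans (add_le_add ?_ ?_)
  · rw [abs_mul, abs_mul, abs_of_pos hmc]
    calc _ ≤ (m * c)⁻¹ * l * 1 := by
          have : 0 ≤ l := (abs_nonneg _).trans hAl
          gcongr
      _ = _ := mul_one _
  · rw [abs_mul, abs_mul, abs_of_pos hH]
    have h3 := (abs_sub (dir (step a y.1 u) i) (dir y.1 i)).trans (add_le_add h2 h1)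
    calc _ ≤ 1 * ((m * c * (1 - dirCorr a))⁻¹ * (1 + 1)) := by gcongr
      _ = _ := by ring

/-- Direction and clock are independent. The mean change of direction is `(dirCorr a - 1) • dir
y.1`, so the jump term contributes `-(m * c)⁻¹ * dir y.1 i * ∫ B`, which cancels the drift term
since `∫ A = ∫ B`. This dictates the factor `(m * c * (1 - dirCorr a))⁻¹`. -/
theorem integral_increment (hm : 0 < m) (hc : 0 < c) (ha1 : a < 1) (i : Fin 3) {y : E3 × ℝ}
    (hy : y.1 ≠ 0) (hA : Integrable (A y) (expMeasure 1)) (hB : Integrable (B y) (expMeasure 1))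
    (hAB : ∫ l, A y l ∂expMeasure 1 = ∫ l, B y l ∂expMeasure 1) :
    ∫ w, increment m c a A B i (y, w) ∂(unif.prod (expMeasure 1)) = 0 := by
  have hdi : Integrable (fun u => dir (step a y.1 u) i) unif :=
    (EuclideanSpace.proj (𝕜 := ℝ) i).integrable_comp (integrable_dir_step a y.1)
  have hmean : ∫ u, dir (step a y.1 u) i ∂unif = dirCorr a * dir y.1 i := by
    have h1 := (EuclideanSpace.proj (𝕜 := ℝ) i).integral_comp_comm (integrable_dir_step a y.1)
    have h2 : ∫ u, dir (step a y.1 u) ∂unif = dirCorr a • dir y.1 := by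
      rw [← integral_dir_step a (norm_dir hy)]
      refine integral_congr_ae (Eventually.of_forall fun u => ?_)
      simp only
      rw [step_eq_norm_smul, dir_smul (norm_pos_iff.2 hy)]
    rw [h2] at h1
    simpa using h1
  have hsub : Integrable (fun u => (m * c * (1 - dirCorr a))⁻¹ *
      (dir (step a y.1 u) i - dir y.1 i)) unif :=
    (hdi.sub (integrable_const _)).const_mul _
  have hi2 := hsub.mul_prod hB
  have hi1 := ((integrable_const (1 : ℝ)).mul_prod hA : Integrable _ (unif.prod (expMeasure 1)))
  have hrw (w : E3 × ℝ) : increment m c a A B i (y, w) =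
      ((m * c)⁻¹ * dir y.1 i) * (1 * A y w.2) + ((m * c * (1 - dirCorr a))⁻¹ *
      (dir (step a y.1 w.1) i - dir y.1 i)) * B y w.2 := by
    rw [increment]; ring
  simp_rw [hrw]
  rw [integral_add (hi1.const_mul _) hi2, integral_const_mul, integral_prod_mul (fun _ : E3 => (1 : ℝ)),
    integral_prod_mul (fun u : E3 => (m * c * (1 - dirCorr a))⁻¹ *
      (dir (step a y.1 u) i - dir y.1 i)), integral_const_mul,
    integral_sub hdi (integrable_const _), hmean, hAB]
  have h1 : 1 - dirCorr a ≠ 0 := (sub_pos.2 (dirCorr_lt_one ha1)).ne'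
  simp only [integral_const, probReal_univ, smul_eq_mul]
  field_simp
  ring

end Increment

/-- The conditions on `A` and `B` under which the sums of `increment` form a martingale. -/
structure IsStepPair (A B : E3 × ℝ → ℝ → ℝ) : Prop where
  measurable_left : Measurable (Function.uncurry A)
  measurable_right : Measurable (Function.uncurry B)
  left_le : ∀ y : E3 × ℝ, y.1 ≠ 0 → ∀ l, 0 < l → |A y l| ≤ l
  right_le : ∀ y l, |B y l| ≤ 1
  integral_eq : ∀ y : E3 × ℝ, y.1 ≠ 0 → ∫ l, A y l ∂expMeasure 1 = ∫ l, B y l ∂expMeasure 1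

/-- The choice without truncation in time: the martingale observed at the jump times. -/
theorem isStepPair_top : IsStepPair (fun _ l => l) (fun _ _ => 1) where
  measurable_left := measurable_snd
  measurable_right := measurable_const
  left_le _ _ _ hl := (abs_of_pos hl).le
  right_le _ _ := by simp
  integral_eq _ _ := by simp [integral_id_expMeasure]

/-- The rescaled time until `t` spent in a state entered at time `y.2`. -/
def cutHold (c t : ℝ) (y : E3 × ℝ) (l : ℝ) : ℝ :=
  c * ‖y.1‖ * (min (y.2 + l / (c * ‖y.1‖)) t - min y.2 t)

/-- The indicator of leaving a state entered at time `y.2` until time `t`. -/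
def cutJump (c t : ℝ) (y : E3 × ℝ) (l : ℝ) : ℝ :=
  if y.2 + l / (c * ‖y.1‖) ≤ t then 1 else 0

theorem cutHold_eq_min {c t : ℝ} (hc : 0 < c) {y : E3 × ℝ} (hy : y.1 ≠ 0) (hyt : y.2 ≤ t) (l : ℝ) :
    cutHold c t y l = min l (c * ‖y.1‖ * (t - y.2)) := by
  have h : 0 < c * ‖y.1‖ := mul_pos hc (norm_pos_iff.2 hy)
  rw [cutHold, min_eq_left hyt, ← min_sub_sub_right, add_sub_cancel_left, mul_min_of_nonneg _ _ h.le,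
    mul_div_cancel₀ _ h.ne']

theorem cutHold_eq_zero {c t : ℝ} (hc : 0 < c) {y : E3 × ℝ} (hyt : t < y.2) {l : ℝ}
    (hl : 0 < l) : cutHold c t y l = 0 := by
  have h : 0 ≤ l / (c * ‖y.1‖) := by positivity
  rw [cutHold, min_eq_right hyt.le, min_eq_right (by linarith), sub_self, mul_zero]

/-- The choice that stops the martingale at time `t`. For a state entered by time `t`, put `s = c *
‖y.1‖ * (t - y.2)`: the hold is `min l s` and the jump indicator is that of `l ≤ s`, and
`integral_min_expMeasure` equates their means. For a state entered later both vanish almost surely.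
-/
theorem isStepPair_cut {c : ℝ} (hc : 0 < c) (t : ℝ) : IsStepPair (cutHold c t) (cutJump c t) where
  measurable_left := by
    unfold cutHold Function.uncurry
    fun_prop
  measurable_right := by
    unfold cutJump Function.uncurry
    refine Measurable.ite (measurableSet_le ?_ measurable_const) measurable_const measurable_const
    fun_prop
  left_le y hy l hl := by
    rcases le_or_gt y.2 t with h | h
    · rw [cutHold_eq_min hc hy h, abs_of_nonneg]
      · exact min_le_left _ _
      · exact le_min hl.le (mul_nonneg (by positivity) (sub_nonneg.2 h))
    · rw [cutHold_eq_zero hc h hl, abs_zero]; exact hl.le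
  right_le y l := by
    unfold cutJump
    split_ifs <;> simp
  integral_eq y hy := by
    have h0 : 0 < c * ‖y.1‖ := mul_pos hc (norm_pos_iff.2 hy)
    rcases le_or_gt y.2 t with h | h
    · have hs : 0 ≤ c * ‖y.1‖ * (t - y.2) := mul_nonneg h0.le (sub_nonneg.2 h)
      simp_rw [cutHold_eq_min hc hy h]
      rw [integral_min_expMeasure hs, ← integral_indicator_one measurableSet_Iic]
      refine integral_congr_ae (Eventually.of_forall fun l => ?_)
      have hiff : y.2 + l / (c * ‖y.1‖) ≤ t ↔ l ≤ c * ‖y.1‖ * (t - y.2) := by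
        rw [← le_sub_iff_add_le', div_le_iff₀ h0, mul_comm (t - y.2)]
      simp [cutJump, indicator, hiff]
    · refine integral_congr_ae ?_
      filter_upwards [ae_expMeasure_pos] with l hl
      have : 0 < l / (c * ‖y.1‖) := by positivity
      rw [cutHold_eq_zero hc h hl, cutJump, if_neg (by linarith)]

/-! ### The martingale along the jumps -/

section StepMartingale

variable {Ω : Type*}

/-- The state before and the time of the `n`-th jump. -/
def stateTime (c : ℝ) (κ : ℕ → Ω → E3) (lam : ℕ → Ω → ℝ) (n : ℕ) (ω : Ω) : E3 × ℝ :=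
  (κ n ω, realJumpTime c (fun j => κ j ω) (fun j => lam j ω) n)

/-- The independent innovations which drive the process. -/
def innovation (a : ℝ) (κ : ℕ → Ω → E3) (lam : ℕ → Ω → ℝ) (n : ℕ) (ω : Ω) : E3 × ℝ :=
  (jumpDir a (κ n ω) (κ (n + 1) ω), lam n ω)

/-- The coordinates of the martingale `X + H K / |K|` at the jump times. -/
def stepMartingale (m c a : ℝ) (A B : E3 × ℝ → ℝ → ℝ) (κ : ℕ → Ω → E3) (lam : ℕ → Ω → ℝ)
    (i : Fin 3) (n : ℕ) (ω : Ω) : ℝ :=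
  ∑ j ∈ Finset.range n, increment m c a A B i (stateTime c κ lam j ω, innovation a κ lam j ω)

variable {m c a : ℝ} {k : E3} {A B : E3 × ℝ → ℝ → ℝ} {κ : ℕ → Ω → E3} {lam : ℕ → Ω → ℝ}

theorem measurable_stateTime {n j : ℕ} (hj : j ≤ n) :
    Measurable[past κ lam n] (stateTime c κ lam j) := by
  have h1 := measurable_past_chain κ lam hj
  refine h1.prodMk ?_
  unfold realJumpTime holdTime
  refine Finset.measurable_fun_sum _ fun i hi => ?_
  have hi := Finset.mem_range.1 hi
  have h2 := measurable_past_chain κ lam (show i ≤ n by omega)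
  have h3 := measurable_past_lam κ lam (show i < n by omega)
  fun_prop

theorem measurable_innovation {n j : ℕ} (hj : j < n) :
    Measurable[past κ lam n] (innovation a κ lam j) := by
  have h1 := measurable_past_chain κ lam hj.le
  have h2 := measurable_past_chain κ lam (Nat.succ_le_of_lt hj)
  have h3 := measurable_past_lam κ lam hj
  unfold innovation
  fun_prop

theorem measurable_stepMartingale (hAB : IsStepPair A B) (i : Fin 3) (n : ℕ) :
    Measurable[past κ lam n] (stepMartingale m c a A B κ lam i n) := by
  unfold stepMartingale
  refine Finset.measurable_fun_sum _ fun j hj => ?_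
  have hj := Finset.mem_range.1 hj
  exact (measurable_increment hAB.measurable_left hAB.measurable_right i).comp
    ((measurable_stateTime hj.le).prodMk (measurable_innovation hj))

variable [mΩ : MeasurableSpace Ω] {P : Measure Ω}

theorem integrable_lam (hl : IsExpSequence P lam) (n : ℕ) : Integrable (lam n) P := by
  have h := integrable_id_expMeasure
  rw [← hl.law n] at h
  exact h.comp_measurable (hl.measurable n)

variable [IsProbabilityMeasure P]

/-- The bound is the same for all pairs `A`, `B`, so it dominates every truncation time `t` at once.
-/
theorem ae_abs_increment_le (hm : 0 < m) (hc : 0 < c) (ha1 : a < 1) (hk : k ≠ 0)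
    (hκ : IsMarkovChainFrom (fun y => unif.map (step a y)) k P κ) (hl : IsExpSequence P lam)
    (i : Fin 3) : ∀ᵐ ω ∂P, ∀ n, ∀ {A B : E3 × ℝ → ℝ → ℝ}, IsStepPair A B →
      |increment m c a A B i (stateTime c κ lam n ω, innovation a κ lam n ω)| ≤
        (m * c)⁻¹ * lam n ω + 2 * (m * c * (1 - dirCorr a))⁻¹ := by
  filter_upwards [ae_chain_ne_zero ha1 hk hκ, ae_lam_pos hl] with ω h1 h2 n A B hAB
  exact abs_increment_le hm hc ha1 i (hAB.left_le _ (h1 n) _ (h2 n)) (hAB.right_le _ _)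

theorem integrable_increment (hm : 0 < m) (hc : 0 < c) (ha1 : a < 1) (hk : k ≠ 0)
    (hκ : IsMarkovChainFrom (fun y => unif.map (step a y)) k P κ) (hl : IsExpSequence P lam)
    (hAB : IsStepPair A B) (i : Fin 3) (n : ℕ) :
    Integrable (fun ω => increment m c a A B i
      (stateTime c κ lam n ω, innovation a κ lam n ω)) P := by
  refine (((integrable_lam hl n).const_mul (m * c)⁻¹).add
    (integrable_const (2 * (m * c * (1 - dirCorr a))⁻¹))).mono' ?_ ?_
  · refine Measurable.aestronglyMeasurable
      ((measurable_increment hAB.measurable_left hAB.measurable_right i).comp ?_)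
    have hle := past_le (lam := lam) hκ.measurable hl.measurable (n + 1)
    exact ((measurable_stateTime n.le_succ).mono hle le_rfl).prodMk
      ((measurable_innovation n.lt_succ_self).mono hle le_rfl)
  · filter_upwards [ae_abs_increment_le (m := m) (c := c) hm hc ha1 hk hκ hl i] with ω h
    exact h n hAB

theorem martingale_stepMartingale (hm : 0 < m) (hc : 0 < c) (ha1 : a < 1) (hk : k ≠ 0)
    (hκ : IsMarkovChainFrom (fun y => unif.map (step a y)) k P κ) (hl : IsExpSequence P lam)
    (hind : IndepFun (fun ω n => κ n ω) (fun ω n => lam n ω) P)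
    (hAB : IsStepPair A B) (i : Fin 3) :
    Martingale (stepMartingale m c a A B κ lam i)
      (pastFiltration hκ.measurable hl.measurable) P := by
  refine martingale_of_condExp_sub_eq_zero_nat
    (fun n => Measurable.stronglyMeasurable (measurable_stepMartingale hAB i n))
    (fun n => integrable_finsetSum _ fun j _ =>
      integrable_increment hm hc ha1 hk hκ hl hAB i j) fun n => ?_
  have hdiff : stepMartingale m c a A B κ lam i (n + 1) - stepMartingale m c a A B κ lam i n =
      fun ω => increment m c a A B i (stateTime c κ lam n ω, innovation a κ lam n ω) := by
    ext ω
    simp [stepMartingale, Finset.sum_range_succ]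
  rw [hdiff]
  have hle := past_le (lam := lam) hκ.measurable hl.measurable
  obtain ⟨hlaw, hindep⟩ := past_indep ha1 hk hκ hl hind n
  refine condExp_eq_zero_of_indep (hle n) (measurable_stateTime le_rfl)
    ((measurable_innovation n.lt_succ_self).mono (hle (n + 1)) le_rfl) hindep
    (measurable_increment hAB.measurable_left hAB.measurable_right i)
    (integrable_increment hm hc ha1 hk hκ hl hAB i n) ?_
  filter_upwards [ae_chain_ne_zero ha1 hk hκ] with ω hω
  have hlaw' : P.map (innovation a κ lam n) = unif.prod (expMeasure 1) := hlaw
  rw [hlaw']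
  refine integral_increment hm hc ha1 i (hω n) ?_ ?_ (hAB.integral_eq _ (hω n))
  · refine integrable_id_expMeasure.mono'
      (hAB.measurable_left.comp measurable_prodMk_left).aestronglyMeasurable ?_
    filter_upwards [ae_expMeasure_pos] with l hl0 using hAB.left_le _ (hω n) l hl0
  · exact Integrable.of_bound
      (hAB.measurable_right.comp measurable_prodMk_left).aestronglyMeasurable 1
      (Eventually.of_forall fun l => hAB.right_le _ l)

theorem integral_stepMartingale (hm : 0 < m) (hc : 0 < c) (ha1 : a < 1) (hk : k ≠ 0)
    (hκ : IsMarkovChainFrom (fun y => unif.map (step a y)) k P κ) (hl : IsExpSequence P lam)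
    (hind : IndepFun (fun ω n => κ n ω) (fun ω n => lam n ω) P)
    (hAB : IsStepPair A B) (i : Fin 3) (n : ℕ) :
    ∫ ω, stepMartingale m c a A B κ lam i n ω ∂P = 0 := by
  have h := (martingale_stepMartingale hm hc ha1 hk hκ hl hind hAB i).setIntegral_eq
    n.zero_le (@MeasurableSet.univ _ (pastFiltration hκ.measurable hl.measurable 0))
  rw [setIntegral_univ, setIntegral_univ] at h
  rw [← h]
  simp [stepMartingale]

/-- The absolute value is the supremum of `f` and `-f`, hence a submartingale. -/
theorem monotone_integral_abs_of_martingale {ℱ : Filtration ℕ mΩ} {f : ℕ → Ω → ℝ}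
    (hf : Martingale f ℱ P) : Monotone fun n => ∫ ω, |f n ω| ∂P := by
  intro n n' hn
  have h := (hf.submartingale.sup hf.neg.submartingale).setIntegral_le hn
    (@MeasurableSet.univ _ (ℱ n))
  rw [setIntegral_univ, setIntegral_univ] at h
  exact h

end StepMartingale

/-! ### Pathwise form of the martingale -/

section Pathwise

variable {Ω : Type*} {m c a γ t : ℝ} {κ : ℕ → Ω → E3} {lam : ℕ → Ω → ℝ} {ω : Ω}

/-- The factor `c * ‖κ j‖` in `cutHold` turns `(m * c)⁻¹ * dir (κ j)` into the velocity `m⁻¹ • κ j`,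
so the drift terms add up to the displacement; the direction terms telescope by `sum_indicator_sub`.
-/
theorem stepMartingale_cut_eq (hc : 0 < c) (ha1 : a < 1)
    (h : IsTypical (fun n => κ n ω) (fun n => lam n ω) γ) (ht : 0 ≤ t) (i : Fin 3) (n : ℕ) :
    stepMartingale m c a (cutHold c t) (cutJump c t) κ lam i n ω =
      displacement m (realJumpTime c (fun n => κ n ω) (fun n => lam n ω)) (fun n => κ n ω) t n i +
      (m * c * (1 - dirCorr a))⁻¹ *
        (dir (κ (min n (countUpTo (realJumpTime c (fun n => κ n ω) (fun n => lam n ω)) t)) ω) i -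
          dir (κ 0 ω) i) := by
  set T := realJumpTime c (fun n => κ n ω) (fun n => lam n ω) with hT
  rw [← sum_indicator_sub (h.strictMono hc) realJumpTime_zero (h.tendsto_realJumpTime hc) ht
    (fun n => dir (κ n ω) i) n, Finset.mul_sum, displacement, WithLp.ofLp_sum, Finset.sum_apply,
    ← Finset.sum_add_distrib, stepMartingale]
  refine Finset.sum_congr rfl fun j _ => ?_
  have hsucc : T j + lam j ω / (c * ‖κ j ω‖) = T (j + 1) := (realJumpTime_succ j).symm
  simp only [increment, stateTime, innovation, cutHold, cutJump, step_jumpDir ha1 (h.ne_zero j),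
    ← hT, hsucc]
  have hκ : κ j ω i = ‖κ j ω‖ * dir (κ j ω) i := by
    conv_lhs => rw [← norm_smul_dir (κ j ω)]
    simp
  rw [PiLp.smul_apply, smul_eq_mul, hκ]
  field_simp

theorem stepMartingale_cut_eq_top (hc : 0 < c)
    (h : IsTypical (fun n => κ n ω) (fun n => lam n ω) γ) {n : ℕ}
    (ht : realJumpTime c (fun n => κ n ω) (fun n => lam n ω) n ≤ t) (i : Fin 3) :
    stepMartingale m c a (cutHold c t) (cutJump c t) κ lam i n ω =
      stepMartingale m c a (fun _ l => l) (fun _ _ => 1) κ lam i n ω := by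
  refine Finset.sum_congr rfl fun j hj => ?_
  have hmono := (h.strictMono hc).monotone
  have hj1 : realJumpTime c (fun n => κ n ω) (fun n => lam n ω) (j + 1) ≤ t :=
    (hmono (Finset.mem_range.1 hj)).trans ht
  have hj0 := (hmono j.le_succ).trans hj1
  have hpos : 0 < c * ‖κ j ω‖ := mul_pos hc (norm_pos_iff.2 (h.ne_zero j))
  have hhold : cutHold c t (stateTime c κ lam j ω) (lam j ω) = lam j ω := by
    rw [realJumpTime_succ] at hj1
    simp only [stateTime, holdTime, cutHold] at hj0 hj1 ⊢
    rw [min_eq_left hj0, min_eq_left hj1, add_sub_cancel_left, mul_div_cancel₀ _ hpos.ne']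
  have hjump : cutJump c t (stateTime c κ lam j ω) (lam j ω) = 1 := by
    rw [realJumpTime_succ] at hj1
    exact if_pos hj1
  simp only [increment, innovation, hhold, hjump]

theorem norm_le_of_abs_apply_le {v : E3} {r : ℝ} (h : ∀ i, |v i| ≤ r) : ‖v‖ ≤ 3 * r := by
  have hr : 0 ≤ r := (abs_nonneg _).trans (h 0)
  rw [EuclideanSpace.norm_eq, Real.sqrt_le_left (by positivity)]
  have hsq (i : Fin 3) : ‖v i‖ ^ 2 ≤ r ^ 2 := by
    rw [Real.norm_eq_abs]; exact pow_le_pow_left₀ (abs_nonneg _) (h i) 2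
  calc ∑ i, ‖v i‖ ^ 2 ≤ ∑ _i : Fin 3, r ^ 2 := Finset.sum_le_sum fun i _ => hsq i
    _ ≤ (3 * r) ^ 2 := by simp; nlinarith [sq_nonneg r]

theorem abs_harmonic_sub_le (hm : 0 < m) (hc : 0 < c) (ha1 : a < 1) (v w : E3) (i : Fin 3) :
    |(m * c * (1 - dirCorr a))⁻¹ * (dir v i - dir w i)| ≤ 2 * (m * c * (1 - dirCorr a))⁻¹ := by
  have hH : 0 < (m * c * (1 - dirCorr a))⁻¹ :=
    inv_pos.2 (mul_pos (mul_pos hm hc) (sub_pos.2 (dirCorr_lt_one ha1)))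
  have h1 := (abs_apply_le_norm (dir v) i).trans (norm_dir_le v)
  have h2 := (abs_apply_le_norm (dir w) i).trans (norm_dir_le w)
  rw [abs_mul, abs_of_pos hH]
  have h3 := (abs_sub (dir v i) (dir w i)).trans (add_le_add h1 h2)
  nlinarith

/-- The limit of `stepMartingale` as the number of steps tends to infinity. -/
def limitMartingale (m c a : ℝ) (x : E3) (X : ℝ → Ω → E3) (κ : ℕ → Ω → E3) (lam : ℕ → Ω → ℝ)
    (i : Fin 3) (t : ℝ) (ω : Ω) : ℝ :=
  X t ω i - x i + (m * c * (1 - dirCorr a))⁻¹ *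
    (dir (κ (countUpTo (realJumpTime c (fun n => κ n ω) (fun n => lam n ω)) t) ω) i -
      dir (κ 0 ω) i)

variable {x : E3} {X : ℝ → Ω → E3}

theorem abs_limitMartingale_sub_le (hm : 0 < m) (hc : 0 < c) (ha1 : a < 1) (i : Fin 3) (t : ℝ)
    (ω : Ω) : |X t ω i - limitMartingale m c a x X κ lam i t ω| ≤
      ‖x‖ + 2 * (m * c * (1 - dirCorr a))⁻¹ := by
  set w := countUpTo (realJumpTime c (fun n => κ n ω) (fun n => lam n ω)) t
  have h : X t ω i - limitMartingale m c a x X κ lam i t ω = x i -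
      (m * c * (1 - dirCorr a))⁻¹ * (dir (κ w ω) i - dir (κ 0 ω) i) := by
    rw [limitMartingale]; ring
  rw [h]
  exact (abs_sub _ _).trans (add_le_add (abs_apply_le_norm _ _) (abs_harmonic_sub_le hm hc ha1 _ _ _))

end Pathwise

/-! ### Moments of the position -/

section Tracer

variable {Ω : Type*} [mΩ : MeasurableSpace Ω] {P : Measure Ω} [IsProbabilityMeasure P]
  {m c a : ℝ} {k : E3} {κ : ℕ → Ω → E3} {lam : ℕ → Ω → ℝ}

theorem ae_isTypical (ha0 : 0 < a) (ha1 : a < 1) (hk : k ≠ 0)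
    (hκ : IsMarkovChainFrom (fun y => unif.map (step a y)) k P κ) (hl : IsExpSequence P lam) :
    ∀ᵐ ω ∂P, IsTypical (fun n => κ n ω) (fun n => lam n ω) (-drift a) := by
  filter_upwards [ae_chain_ne_zero ha1 hk hκ, ae_lam_pos hl, ae_tendsto_log_norm_chain ha0 ha1 hk hκ,
    ae_tendsto_log_lam hl] with ω h1 h2 h3 h4
  exact ⟨h1, h2, neg_pos.2 (drift_neg ha0 ha1), by rwa [neg_neg], h4⟩

/-- The particle only loses energy. At fixed `t` this bounds the position and the stopped
martingale, whatever the number of jumps. -/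
theorem ae_norm_chain_le (ha0 : 0 < a) (ha1 : a < 1) (hk : k ≠ 0)
    (hκ : IsMarkovChainFrom (fun y => unif.map (step a y)) k P κ) :
    ∀ᵐ ω ∂P, ∀ n, ‖κ n ω‖ ≤ ‖k‖ := by
  have hU : ∀ᵐ ω ∂P, ∀ n, ‖jumpDir a (κ n ω) (κ (n + 1) ω)‖ = 1 := by
    rw [ae_all_iff]
    intro n
    have h1 := hκ.measurable n
    have h2 := hκ.measurable (n + 1)
    have h := ae_unif_norm_eq_one
    rw [← (indep_chainPast_jumpDir ha1 hk hκ n).1] at h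
    exact ae_of_ae_map (Measurable.aemeasurable (by fun_prop)) h
  filter_upwards [ae_chain_ne_zero ha1 hk hκ, hU, hκ.initial] with ω h1 h2 h3 n
  induction n with
  | zero => rw [h3]
  | succ n ih =>
    rw [← step_jumpDir ha1 (h1 n) (κ (n + 1) ω)]
    exact (norm_step_le ha0.le ha1.le _ (h2 n)).trans ih

/-- The trajectories of `X` are those of a particle of mass `m` started from `x`, whose momentum
runs through the states `κ`, with jumps at the times given by the clocks `lam`. -/
def FollowsChain (m c : ℝ) (x : E3) (P : Measure Ω) (κ : ℕ → Ω → E3) (lam : ℕ → Ω → ℝ)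
    (X : ℝ → Ω → E3) : Prop :=
  ∀ᵐ ω ∂P, ∀ t : ℝ, 0 ≤ t → ∀ n : ℕ,
    t ≤ realJumpTime c (fun n => κ n ω) (fun n => lam n ω) n →
    X t ω = x + displacement m (realJumpTime c (fun n => κ n ω) (fun n => lam n ω))
      (fun n => κ n ω) t n

variable {x : E3} {X : ℝ → Ω → E3}

theorem ae_norm_position_le (hm : 0 < m) (hc : 0 < c) (ha0 : 0 < a) (ha1 : a < 1) (hk : k ≠ 0)
    (hκ : IsMarkovChainFrom (fun y => unif.map (step a y)) k P κ) (hl : IsExpSequence P lam)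
    (hX : FollowsChain m c x P κ lam X) {t : ℝ} (ht : 0 ≤ t) :
    ∀ᵐ ω ∂P, ‖X t ω‖ ≤ ‖x‖ + m⁻¹ * t * ‖k‖ := by
  filter_upwards [hX, ae_isTypical ha0 ha1 hk hκ hl, ae_norm_chain_le ha0 ha1 hk hκ]
    with ω h1 h2 h3
  obtain ⟨n, hn⟩ := ((h2.tendsto_realJumpTime hc).eventually_ge_atTop t).exists
  rw [h1 t ht n hn]
  refine (norm_add_le _ _).trans (add_le_add_right ?_ _)
  exact norm_displacement_le hm (h2.strictMono hc).monotone realJumpTime_zero ht h3 n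

theorem integrable_position (hm : 0 < m) (hc : 0 < c) (ha0 : 0 < a) (ha1 : a < 1) (hk : k ≠ 0)
    (hκ : IsMarkovChainFrom (fun y => unif.map (step a y)) k P κ) (hl : IsExpSequence P lam)
    (hX : FollowsChain m c x P κ lam X) {t : ℝ} (ht : 0 ≤ t) : Integrable (X t) P := by
  refine Integrable.of_bound ?_ _ (ae_norm_position_le hm hc ha0 ha1 hk hκ hl hX ht)
  -- Measurability of `X t` is obtained from measurable approximations that, along almost every
  -- path, are eventually equal to it.
  have hmeas (n : ℕ) : Measurable fun ω =>
      x + displacement m (realJumpTime c (fun n => κ n ω) (fun n => lam n ω))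
        (fun n => κ n ω) t n := by
    have h1 := hκ.measurable
    have h2 := hl.measurable
    unfold displacement realJumpTime holdTime
    fun_prop
  refine aestronglyMeasurable_of_tendsto_ae atTop (fun n => (hmeas n).aestronglyMeasurable) ?_
  filter_upwards [hX, ae_isTypical ha0 ha1 hk hκ hl] with ω h1 h2
  refine tendsto_const_nhds.congr' ?_
  filter_upwards [(h2.tendsto_realJumpTime hc).eventually_ge_atTop t] with n hn
  exact h1 t ht n hn

theorem ae_tendsto_limitMartingale (hc : 0 < c) (ha0 : 0 < a) (ha1 : a < 1) (hk : k ≠ 0)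
    (hκ : IsMarkovChainFrom (fun y => unif.map (step a y)) k P κ) (hl : IsExpSequence P lam)
    (hX : FollowsChain m c x P κ lam X) {t : ℝ} (ht : 0 ≤ t) (i : Fin 3) :
    ∀ᵐ ω ∂P, Tendsto (fun n => stepMartingale m c a (cutHold c t) (cutJump c t) κ lam i n ω) atTop
      (𝓝 (limitMartingale m c a x X κ lam i t ω)) := by
  filter_upwards [hX, ae_isTypical ha0 ha1 hk hκ hl] with ω h1 h2
  refine tendsto_const_nhds.congr' ?_
  filter_upwards [(h2.tendsto_realJumpTime hc).eventually_ge_atTop t,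
    eventually_ge_atTop (countUpTo (realJumpTime c (fun n => κ n ω) (fun n => lam n ω)) t)]
    with n hn hn'
  rw [stepMartingale_cut_eq hc ha1 h2 ht, min_eq_right hn', limitMartingale, h1 t ht n hn]
  simp

theorem ae_abs_stepMartingale_cut_le (hm : 0 < m) (hc : 0 < c) (ha0 : 0 < a) (ha1 : a < 1)
    (hk : k ≠ 0) (hκ : IsMarkovChainFrom (fun y => unif.map (step a y)) k P κ)
    (hl : IsExpSequence P lam) {t : ℝ} (ht : 0 ≤ t) (i : Fin 3) :
    ∀ᵐ ω ∂P, ∀ n, |stepMartingale m c a (cutHold c t) (cutJump c t) κ lam i n ω| ≤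
      m⁻¹ * t * ‖k‖ + 2 * (m * c * (1 - dirCorr a))⁻¹ := by
  filter_upwards [ae_isTypical ha0 ha1 hk hκ hl, ae_norm_chain_le ha0 ha1 hk hκ] with ω h2 h3 n
  rw [stepMartingale_cut_eq hc ha1 h2 ht]
  refine (abs_add_le _ _).trans (add_le_add ?_ (abs_harmonic_sub_le hm hc ha1 _ _ _))
  exact (abs_apply_le_norm _ _).trans
    (norm_displacement_le hm (h2.strictMono hc).monotone realJumpTime_zero ht h3 n)

theorem measurable_stepMartingale' {A B : E3 × ℝ → ℝ → ℝ} (hκ : ∀ n, Measurable (κ n))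
    (hl : ∀ n, Measurable (lam n)) (hAB : IsStepPair A B) (i : Fin 3) (n : ℕ) :
    Measurable (stepMartingale m c a A B κ lam i n) :=
  (measurable_stepMartingale hAB i n).mono (past_le hκ hl n) le_rfl

/-- At fixed `t` the stopped martingale is bounded uniformly in `n`, so mean zero passes to the
limit. As its `L¹` norms increase in `n`, each is at most that of the limit. -/
theorem limitMartingale_integrable_integral (hm : 0 < m) (hc : 0 < c) (ha0 : 0 < a) (ha1 : a < 1)
    (hk : k ≠ 0) (hκ : IsMarkovChainFrom (fun y => unif.map (step a y)) k P κ)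
    (hl : IsExpSequence P lam) (hind : IndepFun (fun ω n => κ n ω) (fun ω n => lam n ω) P)
    (hX : FollowsChain m c x P κ lam X) {t : ℝ} (ht : 0 ≤ t) (i : Fin 3) :
    Integrable (limitMartingale m c a x X κ lam i t) P ∧
    ∫ ω, limitMartingale m c a x X κ lam i t ω ∂P = 0 ∧
    ∀ n, ∫ ω, |stepMartingale m c a (cutHold c t) (cutJump c t) κ lam i n ω| ∂P ≤
      ∫ ω, |limitMartingale m c a x X κ lam i t ω| ∂P := by
  have hcut := isStepPair_cut hc t
  have hlim := ae_tendsto_limitMartingale hc ha0 ha1 hk hκ hl hX ht i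
  have hbd := ae_abs_stepMartingale_cut_le hm hc ha0 ha1 hk hκ hl ht i
  have hmeas (n : ℕ) := measurable_stepMartingale' (m := m) (c := c) (a := a)
    hκ.measurable hl.measurable hcut i n
  have hbd' : ∀ᵐ ω ∂P, ‖limitMartingale m c a x X κ lam i t ω‖ ≤
      m⁻¹ * t * ‖k‖ + 2 * (m * c * (1 - dirCorr a))⁻¹ := by
    filter_upwards [hlim, hbd] with ω h1 h2
    exact le_of_tendsto h1.abs (Eventually.of_forall h2)
  refine ⟨Integrable.of_bound (aestronglyMeasurable_of_tendsto_ae atTop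
    (fun n => (hmeas n).aestronglyMeasurable) hlim) _ hbd', ?_, fun n => ?_⟩
  · have h1 := tendsto_integral_of_dominated_convergence
      (fun _ => m⁻¹ * t * ‖k‖ + 2 * (m * c * (1 - dirCorr a))⁻¹)
      (fun n => (hmeas n).aestronglyMeasurable) (integrable_const _)
      (fun n => hbd.mono fun ω h => h n) hlim
    simp_rw [integral_stepMartingale hm hc ha1 hk hκ hl hind hcut i] at h1
    exact tendsto_nhds_unique h1 tendsto_const_nhds
  · have h1 := tendsto_integral_of_dominated_convergence
      (F := fun n ω => |stepMartingale m c a (cutHold c t) (cutJump c t) κ lam i n ω|)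
      (fun _ => m⁻¹ * t * ‖k‖ + 2 * (m * c * (1 - dirCorr a))⁻¹)
      (fun n => (hmeas n).abs.aestronglyMeasurable) (integrable_const _)
      (fun n => hbd.mono fun ω h => by rw [Real.norm_eq_abs, abs_abs]; exact h n)
      (hlim.mono fun ω h => h.abs)
    exact (monotone_integral_abs_of_martingale
      (martingale_stepMartingale hm hc ha1 hk hκ hl hind hcut i)).ge_of_tendsto h1 n

theorem norm_integral_position_le (hm : 0 < m) (hc : 0 < c) (ha0 : 0 < a) (ha1 : a < 1)
    (hk : k ≠ 0) (hκ : IsMarkovChainFrom (fun y => unif.map (step a y)) k P κ)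
    (hl : IsExpSequence P lam) (hind : IndepFun (fun ω n => κ n ω) (fun ω n => lam n ω) P)
    (hX : FollowsChain m c x P κ lam X) {t : ℝ} (ht : 0 ≤ t) :
    ‖∫ ω, X t ω ∂P‖ ≤ 3 * (‖x‖ + 2 * (m * c * (1 - dirCorr a))⁻¹) := by
  have hint := integrable_position hm hc ha0 ha1 hk hκ hl hX ht
  have hcoord (i : Fin 3) : |(∫ ω, X t ω ∂P) i| ≤ ‖x‖ + 2 * (m * c * (1 - dirCorr a))⁻¹ := by
    obtain ⟨h1, h2, -⟩ := limitMartingale_integrable_integral hm hc ha0 ha1 hk hκ hl hind hX ht i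
    have h3 : (∫ ω, X t ω ∂P) i = ∫ ω, X t ω i ∂P :=
      ((EuclideanSpace.proj (𝕜 := ℝ) i).integral_comp_comm hint).symm
    have h4 : Integrable (fun ω => X t ω i) P :=
      (EuclideanSpace.proj (𝕜 := ℝ) i).integrable_comp hint
    have h5 : (∫ ω, X t ω ∂P) i = ∫ ω, (X t ω i - limitMartingale m c a x X κ lam i t ω) ∂P := by
      rw [integral_sub h4 h1, h2, sub_zero, h3]
    rw [h5]
    have h6 := norm_integral_le_of_norm_le_const (μ := P)
      (f := fun ω => X t ω i - limitMartingale m c a x X κ lam i t ω)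
      (Eventually.of_forall (abs_limitMartingale_sub_le (x := x) (X := X) (κ := κ) (lam := lam)
        hm hc ha1 i t))
    simpa using h6
  exact norm_le_of_abs_apply_le hcoord

theorem integral_abs_stepMartingale_le (hm : 0 < m) (hc : 0 < c) (ha0 : 0 < a) (ha1 : a < 1)
    (hk : k ≠ 0) (hκ : IsMarkovChainFrom (fun y => unif.map (step a y)) k P κ)
    (hl : IsExpSequence P lam) (hind : IndepFun (fun ω n => κ n ω) (fun ω n => lam n ω) P)
    (hX : FollowsChain m c x P κ lam X) {t : ℝ} (ht : 0 ≤ t) (i : Fin 3) (n : ℕ) :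
    ∫ ω, |stepMartingale m c a (cutHold c t) (cutJump c t) κ lam i n ω| ∂P ≤
      ∫ ω, ‖X t ω‖ ∂P + (‖x‖ + 2 * (m * c * (1 - dirCorr a))⁻¹) := by
  obtain ⟨h1, -, h3⟩ := limitMartingale_integrable_integral hm hc ha0 ha1 hk hκ hl hind hX ht i
  have hint := integrable_position hm hc ha0 ha1 hk hκ hl hX ht
  refine (h3 n).trans ?_
  have h4 : ∫ ω, (‖X t ω‖ + (‖x‖ + 2 * (m * c * (1 - dirCorr a))⁻¹)) ∂P =
      ∫ ω, ‖X t ω‖ ∂P + (‖x‖ + 2 * (m * c * (1 - dirCorr a))⁻¹) := by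
    rw [integral_add hint.norm (integrable_const _)]
    simp
  rw [← h4]
  refine integral_mono h1.abs (hint.norm.add (integrable_const _)) fun ω => ?_
  have h5 := abs_limitMartingale_sub_le (x := x) (X := X) (κ := κ) (lam := lam) hm hc ha1 i t ω
  have h6 := abs_apply_le_norm (X t ω) i
  have h7 := abs_sub_abs_le_abs_sub (limitMartingale m c a x X κ lam i t ω) (X t ω i)
  rw [abs_sub_comm] at h7
  simp only
  linarith

/-- The martingale at the jump times is not bounded in `L¹`. -/
theorem exists_lt_integral_abs_stepMartingale (hm : 0 < m) (hc : 0 < c) (ha1 : a < 1)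
    (hk : k ≠ 0) (hκ : IsMarkovChainFrom (fun y => unif.map (step a y)) k P κ)
    (hl : IsExpSequence P lam) (hind : IndepFun (fun ω n => κ n ω) (fun ω n => lam n ω) P)
    (C : ℝ) : ∃ i n,
      C < ∫ ω, |stepMartingale m c a (fun _ l => l) (fun _ _ => 1) κ lam i n ω| ∂P := by
  by_contra! hcon
  have hmart := martingale_stepMartingale hm hc ha1 hk hκ hl hind isStepPair_top
  have hconv : ∀ᵐ ω ∂P, ∀ i, ∃ z, Tendsto (fun n =>
      stepMartingale m c a (fun _ l => l) (fun _ _ => 1) κ lam i n ω) atTop (𝓝 z) := by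
    rw [ae_all_iff]
    intro i
    refine (hmart i).submartingale.exists_ae_tendsto_of_bdd (R := C.toNNReal) fun n => ?_
    rw [eLpNorm_one_eq_lintegral_enorm, ← ofReal_integral_norm_eq_lintegral_enorm ((hmart i).integrable n)]
    exact ENNReal.ofReal_le_ofReal (hcon i n)
  -- If all three coordinates of an increment are below `1` in absolute value, its norm is at most
  -- `3`; the direction term has norm at most `2 * H`. What remains bounds `(m * c)⁻¹ * lam n`.
  set L := m * c * (3 + 2 * (m * c * (1 - dirCorr a))⁻¹) with hL
  have hH : 0 < (m * c * (1 - dirCorr a))⁻¹ :=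
    inv_pos.2 (mul_pos (mul_pos hm hc) (sub_pos.2 (dirCorr_lt_one ha1)))
  have hL0 : 0 ≤ L := by positivity
  have hev : ∀ᵐ ω ∂P, ∀ᶠ n in atTop, lam n ω ≤ L := by
    filter_upwards [hconv, ae_chain_ne_zero ha1 hk hκ, ae_lam_pos hl] with ω h1 h2 h3
    have hincr (i : Fin 3) : ∀ᶠ n in atTop, |increment m c a (fun _ l => l) (fun _ _ => 1) i
        (stateTime c κ lam n ω, innovation a κ lam n ω)| < 1 := by
      obtain ⟨z, hz⟩ := h1 i
      have h4 := (hz.comp (tendsto_add_atTop_nat 1)).sub hz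
      rw [sub_self] at h4
      refine ((tendsto_order.1 h4.abs).2 1 (by simp)).mono fun n hn => ?_
      simpa [stepMartingale, Finset.sum_range_succ] using hn
    filter_upwards [eventually_all.2 hincr] with n hn
    set H := (m * c * (1 - dirCorr a))⁻¹
    have hmc : 0 < m * c := mul_pos hm hc
    have h4 : ‖((m * c)⁻¹ * lam n ω) • dir (κ n ω) + H • (dir (κ (n + 1) ω) - dir (κ n ω))‖ ≤
        3 * 1 := by
      refine norm_le_of_abs_apply_le fun i => ?_
      have h5 := (hn i).le
      simpa [H, increment, stateTime, innovation, step_jumpDir ha1 (h2 n)] using h5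
    have h5 : ‖H • (dir (κ (n + 1) ω) - dir (κ n ω))‖ ≤ H * 2 := by
      rw [norm_smul, Real.norm_of_nonneg hH.le]
      gcongr
      linarith [norm_sub_le (dir (κ (n + 1) ω)) (dir (κ n ω)), norm_dir_le (κ (n + 1) ω),
        norm_dir_le (κ n ω)]
    have h6 := norm_sub_le (((m * c)⁻¹ * lam n ω) • dir (κ n ω) +
      H • (dir (κ (n + 1) ω) - dir (κ n ω))) (H • (dir (κ (n + 1) ω) - dir (κ n ω)))
    rw [add_sub_cancel_right, norm_smul, norm_dir (h2 n), mul_one,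
      Real.norm_of_nonneg (mul_nonneg (inv_nonneg.2 hmc.le) (h3 n).le)] at h6
    have h7 : (m * c)⁻¹ * lam n ω ≤ 3 + 2 * H := by linarith
    rwa [inv_mul_le_iff₀ hmc] at h7
  -- The contradiction: this probability equals `exp (-L)` for every `n`.
  have hmeas0 : Tendsto (fun n => P (lam n ⁻¹' Ioi L)) atTop (𝓝 0) := by
    have := tendsto_measure_of_ae_tendsto_indicator_of_isFiniteMeasure (μ := P) atTop
      (A := ∅) MeasurableSet.empty (As := fun n => lam n ⁻¹' Ioi L)
      (fun n => hl.measurable n measurableSet_Ioi)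
      (hev.mono fun ω h => h.mono fun n hn => by simpa using hn)
    simpa using this
  simp_rw [measure_lam_preimage hl _ measurableSet_Ioi] at hmeas0
  have h0 := tendsto_nhds_unique tendsto_const_nhds hmeas0
  have h1 := expMeasure_real_Ioi hL0
  rw [measureReal_def, h0] at h1
  exact (Real.exp_pos _).ne h1

/-- Some jump index `n` has a large `L¹` norm of the martingale. For large `t` the version stopped
at `t` nearly attains it at step `n`, and its `L¹` norm is at most `𝔼 ‖X_t‖` plus a constant. -/
theorem tendsto_integral_norm_position (hm : 0 < m) (hc : 0 < c) (ha0 : 0 < a) (ha1 : a < 1)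
    (hk : k ≠ 0) (hκ : IsMarkovChainFrom (fun y => unif.map (step a y)) k P κ)
    (hl : IsExpSequence P lam) (hind : IndepFun (fun ω n => κ n ω) (fun ω n => lam n ω) P)
    (hX : FollowsChain m c x P κ lam X) :
    Tendsto (fun t : ℝ => ∫ ω, ‖X t ω‖ ∂P) atTop atTop := by
  refine tendsto_atTop.2 fun C => ?_
  obtain ⟨i, n, hin⟩ := exists_lt_integral_abs_stepMartingale hm hc ha1 hk hκ hl hind
    (C + (‖x‖ + 2 * (m * c * (1 - dirCorr a))⁻¹))
  have hlim : Tendsto (fun t : ℝ =>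
      ∫ ω, |stepMartingale m c a (cutHold c t) (cutJump c t) κ lam i n ω| ∂P) atTop
      (𝓝 (∫ ω, |stepMartingale m c a (fun _ l => l) (fun _ _ => 1) κ lam i n ω| ∂P)) := by
    refine tendsto_integral_filter_of_dominated_convergence
      (fun ω => ∑ j ∈ Finset.range n, ((m * c)⁻¹ * lam j ω + 2 * (m * c * (1 - dirCorr a))⁻¹))
      (Eventually.of_forall fun t => (measurable_stepMartingale' hκ.measurable hl.measurable
        (isStepPair_cut hc t) i n).abs.aestronglyMeasurable) (Eventually.of_forall fun t => ?_)
      (integrable_finsetSum _ fun j _ =>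
        ((integrable_lam hl j).const_mul _).add (integrable_const _)) ?_
    · filter_upwards [ae_abs_increment_le (m := m) (c := c) hm hc ha1 hk hκ hl i] with ω hω
      rw [Real.norm_eq_abs, abs_abs]
      exact (Finset.abs_sum_le_sum_abs _ _).trans
        (Finset.sum_le_sum fun j _ => hω j (isStepPair_cut hc t))
    · filter_upwards [ae_isTypical ha0 ha1 hk hκ hl] with ω hω
      refine tendsto_const_nhds.congr' ?_
      filter_upwards [eventually_ge_atTop
        (realJumpTime c (fun n => κ n ω) (fun n => lam n ω) n)] with t ht
      rw [stepMartingale_cut_eq_top hc hω ht]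
  filter_upwards [(tendsto_order.1 hlim).1 _ hin, eventually_ge_atTop 0] with t h1 ht
  have h2 := integral_abs_stepMartingale_le hm hc ha0 ha1 hk hκ hl hind hX ht i n
  linarith

end Tracer

/-! ### The particle at rest, and the conclusion -/

theorem ae_chain_eq_zero {Ω : Type*} [MeasurableSpace Ω] {P : Measure Ω} [IsProbabilityMeasure P]
    {a : ℝ} {κ : ℕ → Ω → E3} (hκ : IsMarkovChainFrom (fun y => unif.map (step a y)) 0 P κ) :
    ∀ᵐ ω ∂P, ∀ n, κ n ω = 0 := by
  rw [ae_all_iff]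
  intro n
  induction n with
  | zero => exact hκ.initial
  | succ n ih =>
    have hs : MeasurableSet ({0}ᶜ : Set E3) := (measurableSet_singleton 0).compl
    have hpre := hκ.measurable (n + 1) hs
    have h0 : P⟦κ (n + 1) ⁻¹' {0}ᶜ | chainPast κ n⟧ =ᵐ[P] 0 := by
      filter_upwards [hκ.markov n _ hs, ih] with ω h1 h2
      have hstep : step a 0 = fun _ => 0 := by ext; simp [step]
      rw [h1, h2, hstep, measureReal_def, Measure.map_const]
      simp
    have h1 := integral_condExp (μ := P) (chainPast_le hκ.measurable n)
      (f := (κ (n + 1) ⁻¹' {0}ᶜ).indicator fun _ => (1 : ℝ))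
    rw [integral_congr_ae h0, integral_indicator hpre] at h1
    simp only [Pi.zero_apply, integral_zero, integral_const, smul_eq_mul, mul_one,
      measureReal_restrict_apply_univ] at h1
    have h2 := h1.symm
    rw [measureReal_eq_zero_iff] at h2
    rw [ae_iff]
    exact h2

theorem transition_eq_fun {m M : ℝ} (hm : 0 < m) (hM : 0 < M) :
    transition m M = fun y => unif.map (step (m / (m + M)) y) :=
  funext (transition_eq hm hM)

end QuantumFriction

end

open QuantumFriction in
theorem mainTheorem4 (m M : ℝ) (hm : 0 < m) (hM : 0 < M)
    (x k : QuantumFriction.E3)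
    {Ω : Type*} [MeasurableSpace Ω] (P : Measure Ω) [IsProbabilityMeasure P]
    (X K : ℝ → Ω → QuantumFriction.E3)
    (hXK : QuantumFriction.IsTracerProcess m M x k P X K) :
    (∀ᵐ ω ∂P, ∃ ε : ℝ → ℝ, Tendsto ε atTop (𝓝 0) ∧
      ∀ᶠ t : ℝ in atTop, ‖K t ω‖ = ‖K 0 ω‖ * t ^ (-1 + ε t)) ∧
    (∀ t : ℝ, 0 ≤ t → Integrable (X t) P) ∧
    (k ≠ 0 → Tendsto (fun t : ℝ => ∫ ω, ‖X t ω‖ ∂P) atTop atTop) ∧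
    (∃ C : ℝ, ∀ t : ℝ, 0 ≤ t → ‖∫ ω, X t ω ∂P‖ ≤ C) := by
  obtain ⟨⟨κ, lam, hκ, hl, hind, hK⟩, hX⟩ := hXK
  rw [transition_eq_fun hm hM] at hκ
  by_cases hk : k = 0
  · subst hk
    have hK0 : ∀ᵐ ω ∂P, ∀ t : ℝ, 0 ≤ t → K t ω = 0 := by
      filter_upwards [hK, ae_chain_eq_zero hκ] with ω h1 h2 t ht
      rw [h1 t ht, h2]
    have hX0 : ∀ᵐ ω ∂P, ∀ t : ℝ, 0 ≤ t → X t ω = x := by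
      filter_upwards [hX, hK0] with ω h1 h2 t ht
      rw [h1 t ht, intervalIntegral.integral_congr (g := fun _ => 0)]
      · simp
      · intro s hs
        rw [uIcc_of_le ht] at hs
        simp [h2 s hs.1]
    have hXt {t : ℝ} (ht : 0 ≤ t) : X t =ᵐ[P] fun _ => x := hX0.mono fun ω h => h t ht
    refine ⟨?_, fun t ht => (integrable_const x).congr (hXt ht).symm, fun h => absurd rfl h,
      ‖x‖, fun t ht => ?_⟩
    · filter_upwards [hK0] with ω h
      -- Both momenta vanish, so any exponent would do.
      refine ⟨fun _ => 0, tendsto_const_nhds, ?_⟩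
      filter_upwards [eventually_ge_atTop 0] with t ht
      simp [h t ht, h 0 le_rfl]
    · rw [integral_congr_ae (hXt ht)]
      simp
  · have hc := rateConst_pos hm hM
    have ha0 : 0 < m / (m + M) := by positivity
    have ha1 : m / (m + M) < 1 := by rw [div_lt_one (by positivity)]; linarith
    have htyp := ae_isTypical ha0 ha1 hk hκ hl
    have hK' : ∀ᵐ ω ∂P, ∀ t : ℝ, 0 ≤ t → K t ω = κ (countUpTo
        (realJumpTime (rateConst m M) (fun n => κ n ω) (fun n => lam n ω)) t) ω := by
      filter_upwards [hK, htyp] with ω h1 h2 t ht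
      rw [h1 t ht, jumpCount_eq_countUpTo hm hM h2 ht]
    have hfol : FollowsChain m (rateConst m M) x P κ lam X := by
      filter_upwards [hX, hK', htyp] with ω h1 h2 h3 t ht n hn
      rw [h1 t ht, ← integral_eq_displacement (h3.strictMono hc) realJumpTime_zero
        (h3.tendsto_realJumpTime hc) ht hn]
      congr 1
      refine intervalIntegral.integral_congr fun s hs => ?_
      rw [uIcc_of_le ht] at hs
      simp only [h2 s hs.1]
    refine ⟨?_, fun t ht => integrable_position hm hc ha0 ha1 hk hκ hl hfol ht,
      fun _ => tendsto_integral_norm_position hm hc ha0 ha1 hk hκ hl hind hfol,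
      _, fun t ht => norm_integral_position_le hm hc ha0 ha1 hk hκ hl hind hfol ht⟩
    filter_upwards [hK', htyp] with ω h1 h2
    obtain ⟨ε, hε, hev⟩ := h2.exists_norm_eq_rpow hc
    refine ⟨ε, hε, ?_⟩
    -- The first jump time is strictly positive, so `K 0` is the initial state of the chain.
    have h0 : countUpTo (realJumpTime (rateConst m M) (fun n => κ n ω) (fun n => lam n ω)) 0 = 0 :=
      countUpTo_eq (h2.strictMono hc) realJumpTime_zero (h2.tendsto_realJumpTime hc)
        realJumpTime_zero.le (realJumpTime_zero.symm.trans_lt (h2.strictMono hc zero_lt_one))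
    filter_upwards [hev, eventually_ge_atTop 0] with t ht ht0
    rw [h1 t ht0, h1 0 le_rfl, h0]
    exact ht
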